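/- All graphs are finite, simple and undirected. For a graph $G$ let $A(G)$ be its adjacency matrix, $D(G)$ the diagonal matrix of its vertex degrees, and let $q(G)$, the signless Laplacian spectral radius of $G$, be the largest eigenvalue of $Q(G)=D(G)+A(G)$. For integers $n>k\ge 1$ let $S_{n,k}=K_k\vee\overline{K}_{n-k}$ be the graph of order $n$ obtained from a clique on $k$ vertices and an independent set on $n-k$ vertices by adding all edges between them, and (for $n\ge k+2$) let $S_{n,k}^+$ be the graph obtained from $S_{n,k}$ by adding one edge (between two vertices of the independent set). A graph contains a tree $T$ if it has a (not necessarily induced) subgraph isomorphic to $T$, and equality of graphs means isomorphism. Theorem. Let $k$ and $n$ be positive integers with $n\ge 256000k^8$, and let $G$ be a graph of order $n$. (a) If $q(G)\ge q(S_{n,k})$, then $G$ contains all trees on $2k+2$ vertices unless $G=S_{n,k}$. (b) If $q(G)\ge q(S_{n,k}^+)$, then $G$ contains all trees on $2k+3$ vertices unless $G=S_{n,k}^+$. Moreover, $S_{n,k}$ does not contain all trees on $2k+2$ vertices, and it is the unique graph (up to isomorphism) that maximises $q$ among the graphs of order $n$ that do not contain all trees on $2k+2$ vertices; likewise, $S_{n,k}^+$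 does not contain all trees on $2k+3$ vertices, and it is the unique graph (up to isomorphism) that maximises $q$ among the graphs of order $n$ that do not contain all trees on $2k+3$ vertices. -/

import Mathlib

/-- The join `G ∨ H` of two graphs: disjoint copies of `G` and `H` together with all edges between
the two vertex sets. -/
def graphJoin {V W : Type*} (G : SimpleGraph V) (H : SimpleGraph W) : SimpleGraph (V ⊕ W) :=
  SimpleGraph.sum G H ⊔ completeBipartiteGraph V W

/-- `S_{n,k}`: the join of the clique `K_k` with the independent set on `n - k` vertices. -/
def graphS (n k : ℕ) : SimpleGraph (Fin k ⊕ Fin (n - k)) :=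
  graphJoin (⊤ : SimpleGraph (Fin k)) (⊥ : SimpleGraph (Fin (n - k)))

/-- `S⁺_{n,k}`: the graph `S_{n,k}` plus one edge, which joins the vertices `0` and `1` of the
independent set of size `n - k` (up to isomorphism the choice of the new edge does not matter;
meant for `n ≥ k + 2`). -/
def graphSPlus (n k : ℕ) : SimpleGraph (Fin k ⊕ Fin (n - k)) :=
  graphS n k ⊔ SimpleGraph.fromRel (fun x y =>
    ∃ i j : Fin (n - k), x = Sum.inr i ∧ y = Sum.inr j ∧ i.val = 0 ∧ j.val = 1)

open Classical in
/-- The signless Laplacian matrix `Q(G) = D(G) + A(G)`. -/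
noncomputable def signlessLaplacian {V : Type*} [Fintype V] (G : SimpleGraph V) : Matrix V V ℝ :=
  G.degMatrix ℝ + G.adjMatrix ℝ

open Classical in
/-- The signless Laplacian spectral radius `q(G)`: the largest eigenvalue of `Q(G)`. -/
noncomputable def signlessRadius {V : Type*} [Fintype V] (G : SimpleGraph V) : ℝ :=
  sSup {μ : ℝ | Module.End.HasEigenvalue (Matrix.toLin' (signlessLaplacian G)) μ}

open Classical in
/-- On a nonempty graph the supremum that defines `q(G)` is attained: it is a largest eigenvalue. -/
theorem signlessRadius_isGreatest {V : Type*} [Fintype V] [Nonempty V] (G : SimpleGraph V) :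
    IsGreatest {μ : ℝ | Module.End.HasEigenvalue (Matrix.toLin' (signlessLaplacian G)) μ}
      (signlessRadius G) := by
  have hA : (signlessLaplacian G).IsHermitian := by
    unfold signlessLaplacian SimpleGraph.degMatrix
    refine Matrix.IsHermitian.add ?_ ?_
    · simp [Matrix.IsHermitian]
    · simp [Matrix.IsHermitian]
  have hset : {μ : ℝ | Module.End.HasEigenvalue (Matrix.toLin' (signlessLaplacian G)) μ}
      = Set.range hA.eigenvalues := by
    rw [← hA.spectrum_real_eq_range_eigenvalues]
    ext μ
    rw [Set.mem_ofPred_eq, Module.End.hasEigenvalue_iff_mem_spectrum, Matrix.spectrum_toLin']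
  have hfin : (Set.range hA.eigenvalues).Finite := Set.finite_range _
  have hne : (Set.range hA.eigenvalues).Nonempty := Set.range_nonempty _
  unfold signlessRadius
  rw [hset]
  exact ⟨hne.csSup_mem hfin, fun x hx => le_csSup hfin.bddAbove hx⟩

/-- `G` contains every tree on `m` vertices as a (not necessarily induced) subgraph. -/
def ContainsAllTrees {V : Type*} (G : SimpleGraph V) (m : ℕ) : Prop :=
  ∀ T : SimpleGraph (Fin m), T.IsTree → SimpleGraph.IsContained T G

/-! The heart is a stability statement, `exists_dominating`: a graph `G` that misses a tree on at
most `2k + 3` vertices and has `q(G) ≥ n + 2k - 2 - 3k²/n` contains `k` vertices adjacent to all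
others. A test vector shows that `S_{n,k}` reaches this bound, and `S⁺_{n,k}` has strictly larger
`q`.

For the stability, let `x` be a nonnegative eigenvector with maximum entry 1 and let `S` be the sum
of its entries. Missing a tree forces `O(kn)` edges by degeneracy, and at most `k` vertices of
degree at least `n - n/(4k)`; call their set `D`. Summing the eigenvalue equations gives `∑ (q - 2
deg v) x v = 0`. Vertices of small degree carry a coefficient close to `n`, vertices of `D` one of
at least `-n`, and the rest have negligible weight, so `S` is at most about `2 ∑_D x ≤ 2|D|`
(`weight_le_of_eigenvector`). The equation at a maximum entry gives `S ≥ 2k - 3k²/n`. Hence `|D| =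
k` and every entry on `D` is close to 1. A vertex of `D` with a non-neighbour would push `S` up to
nearly `2k + 1`, which is too much.

Once `D` dominates, the question is which edges remain outside `D`. A tree is placed with most of
one colour class in `D`, and its few edges avoiding `D` are laid on prescribed edges outside. One
such edge yields all trees on `2k + 2` vertices, two yield all trees on `2k + 3`, so only `S_{n,k}`
and `S⁺_{n,k}` can survive. Conversely, these two graphs miss a path. -/

/-! ### Quadratic form, Rayleigh principle and isomorphism invariance of `q` -/

open Classical in
theorem signlessLaplacian_mulVec_apply {V : Type*} [Fintype V] (G : SimpleGraph V) (x : V → ℝ)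
    (v : V) : (signlessLaplacian G).mulVec x v = ∑ u, if G.Adj v u then x v + x u else 0 := by
  unfold signlessLaplacian
  rw [Matrix.add_mulVec, Pi.add_apply, SimpleGraph.degMatrix_mulVec_apply,
    SimpleGraph.adjMatrix_mulVec_apply, SimpleGraph.neighborFinset_eq_filter, Finset.sum_filter,
    SimpleGraph.degree_eq_sum_if_adj, Finset.sum_mul, ← Finset.sum_add_distrib]
  refine Finset.sum_congr rfl fun u _ => ?_
  split_ifs <;> simp

theorem signlessLaplacian_isHermitian {V : Type*} [Fintype V] (G : SimpleGraph V) :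
    (signlessLaplacian G).IsHermitian := by
  classical
  unfold signlessLaplacian
  exact (SimpleGraph.isHermitian_degMatrix ℝ G).add (SimpleGraph.isHermitian_adjMatrix ℝ G)

open Classical in
/-- Twice the quadratic form of the signless Laplacian. -/
noncomputable def signlessForm {V : Type*} [Fintype V] (G : SimpleGraph V) (x : V → ℝ) : ℝ :=
  ∑ v, ∑ u, if G.Adj v u then (x v + x u) ^ 2 else 0

theorem two_mul_dotProduct_signlessLaplacian {V : Type*} [Fintype V] (G : SimpleGraph V)
    (x : V → ℝ) : 2 * dotProduct x ((signlessLaplacian G).mulVec x) = signlessForm G x := by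
  classical
  have h1 : dotProduct x ((signlessLaplacian G).mulVec x)
      = ∑ v, ∑ u, if G.Adj v u then x v * (x v + x u) else 0 := by
    unfold dotProduct
    refine Finset.sum_congr rfl fun v _ => ?_
    rw [signlessLaplacian_mulVec_apply, Finset.mul_sum]
    refine Finset.sum_congr rfl fun u _ => ?_
    split_ifs <;> simp
  have h2 : dotProduct x ((signlessLaplacian G).mulVec x)
      = ∑ v, ∑ u, if G.Adj v u then x u * (x v + x u) else 0 := by
    rw [h1, Finset.sum_comm]
    refine Finset.sum_congr rfl fun v _ => Finset.sum_congr rfl fun u _ => ?_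
    rw [G.adj_comm, add_comm (x u)]
  rw [two_mul]
  nth_rewrite 1 [h1]
  rw [h2, ← Finset.sum_add_distrib]
  unfold signlessForm
  refine Finset.sum_congr rfl fun v _ => ?_
  rw [← Finset.sum_add_distrib]
  refine Finset.sum_congr rfl fun u _ => ?_
  split_ifs
  · ring
  · simp

-- An eigenvector of `q • 1 - Q` for `λ` is an eigenvector of `Q` for `q - λ`, and `q` is the
-- largest eigenvalue of `Q`, so `λ ≥ 0`.
open Classical in
theorem posSemidef_signlessRadius_sub {V : Type*} [Fintype V] (G : SimpleGraph V) :
    (signlessRadius G • (1 : Matrix V V ℝ) - signlessLaplacian G).PosSemidef := by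
  cases isEmpty_or_nonempty V
  · rw [Subsingleton.elim (signlessRadius G • (1 : Matrix V V ℝ) - signlessLaplacian G) 0]
    exact Matrix.PosSemidef.zero
  have hA : (signlessRadius G • (1 : Matrix V V ℝ) - signlessLaplacian G).IsHermitian := by
    refine Matrix.IsHermitian.sub ?_ (signlessLaplacian_isHermitian G)
    simp [Matrix.IsHermitian]
  rw [hA.posSemidef_iff_eigenvalues_nonneg]
  intro i
  have hi := hA.mulVec_eigenvectorBasis i
  have hne : (hA.eigenvectorBasis i).ofLp ≠ 0 := by
    intro h
    have := hA.eigenvectorBasis.orthonormal.ne_zero i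
    apply this
    ext j
    simpa using congrFun h j
  have heig : Module.End.HasEigenvalue (Matrix.toLin' (signlessLaplacian G))
      (signlessRadius G - hA.eigenvalues i) := by
    refine Module.End.hasEigenvalue_of_hasEigenvector
      (x := (hA.eigenvectorBasis i).ofLp) ⟨?_, hne⟩
    rw [Module.End.mem_eigenspace_iff, Matrix.toLin'_apply, sub_smul, ← hi, Matrix.sub_mulVec,
      Matrix.smul_mulVec, Matrix.one_mulVec]
    simp
  have := (signlessRadius_isGreatest G).2 heig
  simp only [Pi.zero_apply]
  linarith

theorem signlessForm_le {V : Type*} [Fintype V] (G : SimpleGraph V) (x : V → ℝ) :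
    signlessForm G x ≤ 2 * signlessRadius G * ∑ v, x v ^ 2 := by
  classical
  have h := (posSemidef_signlessRadius_sub G).dotProduct_mulVec_nonneg x
  rw [Matrix.sub_mulVec, Matrix.smul_mulVec, Matrix.one_mulVec, dotProduct_sub,
    dotProduct_smul] at h
  have h3 : dotProduct (star x) x = ∑ v, x v ^ 2 := by
    simp [dotProduct, sq]
  have h4 := two_mul_dotProduct_signlessLaplacian G x
  rw [h3, star_trivial, smul_eq_mul] at h
  linarith

/-- A zero of the form of a positive semidefinite matrix lies in its kernel, so equality in the
Rayleigh bound forces the eigenvalue equation. -/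
theorem mulVec_eq_of_signlessForm_eq {V : Type*} [Fintype V] (G : SimpleGraph V) (x : V → ℝ)
    (h : signlessForm G x = 2 * signlessRadius G * ∑ v, x v ^ 2) :
    (signlessLaplacian G).mulVec x = signlessRadius G • x := by
  classical
  have h0 := ((posSemidef_signlessRadius_sub G).dotProduct_mulVec_zero_iff x).1 (by
    rw [Matrix.sub_mulVec, Matrix.smul_mulVec, Matrix.one_mulVec, dotProduct_sub,
      dotProduct_smul]
    have h3 : dotProduct (star x) x = ∑ v, x v ^ 2 := by
      simp [dotProduct, sq]
    have h4 := two_mul_dotProduct_signlessLaplacian G x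
    rw [h3, star_trivial, smul_eq_mul]
    linarith)
  rw [Matrix.sub_mulVec, Matrix.smul_mulVec, Matrix.one_mulVec, sub_eq_zero] at h0
  exact h0.symm

open Classical in
/-- A nonnegative eigenvector for the signless Laplacian spectral radius. -/
theorem exists_nonneg_eigenvector {V : Type*} [Fintype V] [Nonempty V] (G : SimpleGraph V) :
    ∃ x : V → ℝ, (∀ v, 0 ≤ x v) ∧ (∃ v, 0 < x v) ∧
      (∀ v, signlessRadius G * x v = ∑ u, if G.Adj v u then x v + x u else 0) ∧
      signlessForm G x = 2 * signlessRadius G * ∑ v, x v ^ 2 := by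
  obtain ⟨y, hy⟩ := (signlessRadius_isGreatest G).1.exists_hasEigenvector
  have hyQ : (signlessLaplacian G).mulVec y = signlessRadius G • y := by
    simpa using hy.apply_eq_smul
  have h1 : signlessForm G y = 2 * signlessRadius G * ∑ v, y v ^ 2 := by
    rw [← two_mul_dotProduct_signlessLaplacian, hyQ, dotProduct_smul, smul_eq_mul, mul_assoc]
    simp [dotProduct, sq]
  -- Absolute values keep the norm and do not lower the form, so `|y|` attains the Rayleigh bound as
  -- well.
  have h2 : signlessForm G y ≤ signlessForm G (fun v => |y v|) := by
    unfold signlessForm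
    refine Finset.sum_le_sum fun v _ => Finset.sum_le_sum fun u _ => ?_
    split_ifs
    · rw [← sq_abs (y v + y u)]
      gcongr
      exact abs_add_le _ _
    · exact le_rfl
  have h3 := signlessForm_le G (fun v => |y v|)
  have h4 : ∑ v, |y v| ^ 2 = ∑ v, y v ^ 2 := by simp
  have h5 : signlessForm G (fun v => |y v|) = 2 * signlessRadius G * ∑ v, |y v| ^ 2 := by
    apply le_antisymm h3
    rw [h4, ← h1]
    exact h2
  refine ⟨fun v => |y v|, fun v => abs_nonneg _, ?_, ?_, h5⟩
  · by_contra! hcon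
    apply hy.2
    funext v
    exact abs_nonpos_iff.1 (hcon v)
  · intro v
    have h6 := signlessLaplacian_mulVec_apply G (fun v => |y v|) v
    rwa [mulVec_eq_of_signlessForm_eq G _ h5] at h6

theorem signlessForm_iso {V W : Type*} [Fintype V] [Fintype W] {G : SimpleGraph V}
    {H : SimpleGraph W} (e : G ≃g H) (x : W → ℝ) :
    signlessForm G (fun v => x (e v)) = signlessForm H x := by
  classical
  unfold signlessForm
  refine Fintype.sum_equiv e.toEquiv _ _ fun v => Fintype.sum_equiv e.toEquiv _ _ fun u => ?_
  have : H.Adj (e.toEquiv v) (e.toEquiv u) ↔ G.Adj v u := e.map_adj_iff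
  simp only [this]
  rfl

theorem signlessRadius_le_of_iso {V W : Type*} [Fintype V] [Fintype W] [Nonempty W]
    {G : SimpleGraph V} {H : SimpleGraph W} (e : G ≃g H) :
    signlessRadius H ≤ signlessRadius G := by
  classical
  obtain ⟨x, hx0, ⟨w, hw⟩, -, hx⟩ := exists_nonneg_eigenvector H
  have h2 := signlessForm_le G (fun v => x (e v))
  rw [signlessForm_iso e, hx] at h2
  have h4 : ∑ v, x (e v) ^ 2 = ∑ w, x w ^ 2 := Fintype.sum_equiv e.toEquiv _ _ fun v => rfl
  rw [h4] at h2
  have h3 : 0 < ∑ v, x v ^ 2 :=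
    Finset.sum_pos' (fun v _ => sq_nonneg _) ⟨w, Finset.mem_univ _, by positivity⟩
  nlinarith

theorem signlessRadius_eq_of_iso {V W : Type*} [Fintype V] [Fintype W] [Nonempty W]
    {G : SimpleGraph V} {H : SimpleGraph W} (e : G ≃g H) :
    signlessRadius G = signlessRadius H := by
  have : Nonempty V := e.toEquiv.nonempty
  exact le_antisymm (signlessRadius_le_of_iso e.symm) (signlessRadius_le_of_iso e)

/-! ### Adjacency and spectral bounds for `S_{n,k}` and `S⁺_{n,k}` -/

@[simp] theorem graphS_adj_inl_inl {n k : ℕ} (i j : Fin k) :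
    (graphS n k).Adj (Sum.inl i) (Sum.inl j) ↔ i ≠ j := by
  simp [graphS, graphJoin]

@[simp] theorem graphS_adj_inl_inr {n k : ℕ} (i : Fin k) (j : Fin (n - k)) :
    (graphS n k).Adj (Sum.inl i) (Sum.inr j) := by
  simp [graphS, graphJoin]

@[simp] theorem graphS_adj_inr_inl {n k : ℕ} (i : Fin k) (j : Fin (n - k)) :
    (graphS n k).Adj (Sum.inr j) (Sum.inl i) := by
  simp [graphS, graphJoin]

@[simp] theorem graphS_adj_inr_inr {n k : ℕ} (i j : Fin (n - k)) :
    ¬ (graphS n k).Adj (Sum.inr i) (Sum.inr j) := by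
  simp [graphS, graphJoin]

@[simp] theorem graphSPlus_adj_inl {n k : ℕ} (i : Fin k) (w : Fin k ⊕ Fin (n - k)) :
    (graphSPlus n k).Adj (Sum.inl i) w ↔ (graphS n k).Adj (Sum.inl i) w := by
  simp [graphSPlus]

@[simp] theorem graphSPlus_adj_inr_inl {n k : ℕ} (i : Fin k) (j : Fin (n - k)) :
    (graphSPlus n k).Adj (Sum.inr j) (Sum.inl i) := by
  simp [graphSPlus]

@[simp] theorem graphSPlus_adj_inr_inr {n k : ℕ} (i j : Fin (n - k)) :
    (graphSPlus n k).Adj (Sum.inr i) (Sum.inr j) ↔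
      i.val = 0 ∧ j.val = 1 ∨ j.val = 0 ∧ i.val = 1 := by
  simp only [graphSPlus, SimpleGraph.sup_adj, graphS_adj_inr_inr, false_or,
    SimpleGraph.fromRel_adj, Sum.inr.injEq]
  constructor
  · rintro ⟨-, ⟨a, b, rfl, rfl, h⟩ | ⟨a, b, rfl, rfl, h⟩⟩
    · exact Or.inl h
    · exact Or.inr h
  · rintro (h | h)
    · exact ⟨fun hij => by cases hij; omega, Or.inl ⟨i, j, rfl, rfl, h⟩⟩
    · exact ⟨fun hij => by cases hij; omega, Or.inr ⟨j, i, rfl, rfl, h⟩⟩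

/-- Rayleigh quotient of the vector equal to `n` on the clique and `k` on the independent set. The
ratio `k / n` approximates the true eigenvector ratio `k / (q - k)`. -/
theorem le_signlessRadius_graphS {n k : ℕ} (hk : 1 ≤ k) (hkn : k ≤ n) :
    (n : ℝ) + 2 * k - 2 - 3 * k ^ 2 / n ≤ signlessRadius (graphS n k) := by
  classical
  have hform := signlessForm_le (graphS n k) (Sum.elim (fun _ => (n : ℝ)) (fun _ => (k : ℝ)))
  have hn0 : (0 : ℝ) < n := by exact_mod_cast (by omega : 0 < n)
  have hk0 : (1 : ℝ) ≤ k := by exact_mod_cast hk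
  have hkn' : (k : ℝ) ≤ n := by exact_mod_cast hkn
  have h1 : signlessForm (graphS n k) (Sum.elim (fun _ => (n : ℝ)) (fun _ => (k : ℝ)))
      = k * ((k - 1) * (n + n) ^ 2 + (n - k) * (n + k) ^ 2) + (n - k) * (k * (n + k) ^ 2) := by
    unfold signlessForm
    have h : ∀ i : Fin k, (∑ j : Fin k, if ¬ i = j then ((n : ℝ) + n) ^ 2 else 0)
        = (k - 1) * (n + n) ^ 2 := by
      intro i
      rw [← Finset.sum_filter, Finset.sum_const, Finset.filter_ne]
      simp [Finset.card_erase_of_mem, Nat.cast_sub hk]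
    simp only [Fintype.sum_sum_type, graphS_adj_inl_inl, graphS_adj_inl_inr, graphS_adj_inr_inl,
      graphS_adj_inr_inr, Sum.elim_inl, Sum.elim_inr, ne_eq, h, if_true, if_false,
      Finset.sum_const, Finset.card_univ, Fintype.card_fin, nsmul_eq_mul, Nat.cast_sub hkn]
    ring
  have h2 : ∑ v : Fin k ⊕ Fin (n - k),
      (Sum.elim (fun _ => (n : ℝ)) (fun _ => (k : ℝ)) v : ℝ) ^ 2
      = k * n ^ 2 + (n - k) * k ^ 2 := by
    simp [Fintype.sum_sum_type, Nat.cast_sub hkn]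
  rw [h1, h2] at hform
  have hpos : (0 : ℝ) < n * (k * n ^ 2 + (n - k) * k ^ 2) := by
    have : (0 : ℝ) ≤ (n - k) * k ^ 2 := mul_nonneg (by linarith) (by positivity)
    positivity
  have h3 : ((n : ℝ) + 2 * k - 2 - 3 * k ^ 2 / n) * (n * (k * n ^ 2 + (n - k) * k ^ 2))
      = (n * (n + 2 * k - 2) - 3 * k ^ 2) * (k * n ^ 2 + (n - k) * k ^ 2) := by
    field_simp
  refine le_of_mul_le_mul_right ?_ hpos
  rw [h3]
  refine le_trans ?_ (by nlinarith [mul_le_mul_of_nonneg_left hform hn0.le] :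
    (n : ℝ) * ((k * ((k - 1) * (n + n) ^ 2 + (n - k) * (n + k) ^ 2)
      + (n - k) * (k * (n + k) ^ 2)) / 2) ≤ _)
  have h4 : (0 : ℝ) ≤ k * (k ^ 2 * n ^ 2 + 2 * k * n * (n - k) + 4 * k ^ 3 * (n - k) + k ^ 4) := by
    have : (0 : ℝ) ≤ n - k := by linarith
    positivity
  linear_combination h4

theorem graphS_le_graphSPlus (n k : ℕ) : graphS n k ≤ graphSPlus n k := le_sup_left

/-- A nonnegative eigenvector of `S_{n,k}` is positive at an end of the new edge, so that edge
strictly raises the form. For `j` independent, `(q - k) x_j` is the clique sum; were one `x_j` zero,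
all clique entries and then, as `q > k`, all entries would vanish. -/
theorem signlessRadius_graphS_lt {n k : ℕ} (hk : 1 ≤ k) (hkn : k + 2 ≤ n)
    (hq : (k : ℝ) < signlessRadius (graphS n k)) :
    signlessRadius (graphS n k) < signlessRadius (graphSPlus n k) := by
  classical
  have : Nonempty (Fin k ⊕ Fin (n - k)) := ⟨Sum.inl ⟨0, hk⟩⟩
  obtain ⟨x, hx0, ⟨w, hw⟩, hx, hxf⟩ := exists_nonneg_eigenvector (graphS n k)
  let v₀ : Fin (n - k) := ⟨0, by omega⟩
  let v₁ : Fin (n - k) := ⟨1, by omega⟩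
  have hr : ∀ j : Fin (n - k), signlessRadius (graphS n k) * x (Sum.inr j)
      = k * x (Sum.inr j) + ∑ i : Fin k, x (Sum.inl i) := by
    intro j
    rw [hx]
    simp [Fintype.sum_sum_type, Finset.sum_add_distrib]
  have hpos : 0 < x (Sum.inr v₀) := by
    refine lt_of_le_of_ne (hx0 _) fun h0 => ?_
    have h1 := hr v₀
    rw [← h0, mul_zero, mul_zero, zero_add] at h1
    rcases w with i | j
    · have := (Finset.sum_eq_zero_iff_of_nonneg fun i _ => hx0 (Sum.inl i)).1 h1.symm i
        (Finset.mem_univ _)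
      linarith
    · have := hr j
      rw [← h1] at this
      nlinarith
  have hlt : signlessForm (graphS n k) x < signlessForm (graphSPlus n k) x := by
    unfold signlessForm
    have hle : ∀ v u, (if (graphS n k).Adj v u then (x v + x u) ^ 2 else 0)
        ≤ if (graphSPlus n k).Adj v u then (x v + x u) ^ 2 else 0 := by
      intro v u
      by_cases h : (graphS n k).Adj v u
      · simp [h, graphS_le_graphSPlus n k h]
      · simp only [h, if_false]
        positivity
    refine Finset.sum_lt_sum (fun v _ => Finset.sum_le_sum fun u _ => hle v u)
      ⟨Sum.inr v₀, Finset.mem_univ _, ?_⟩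
    refine Finset.sum_lt_sum (fun u _ => hle _ u) ⟨Sum.inr v₁, Finset.mem_univ _, ?_⟩
    have h : (graphSPlus n k).Adj (Sum.inr v₀) (Sum.inr v₁) :=
      (graphSPlus_adj_inr_inr _ _).2 (Or.inl ⟨rfl, rfl⟩)
    simp only [h, graphS_adj_inr_inr, if_true, if_false]
    have := hx0 (Sum.inr v₁)
    positivity
  have h2 := signlessForm_le (graphSPlus n k) x
  have h3 : 0 < ∑ v, x v ^ 2 :=
    Finset.sum_pos' (fun v _ => sq_nonneg _) ⟨w, Finset.mem_univ _, by positivity⟩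
  nlinarith

/-! ### Greedy tree embedding and sparsity -/

open Classical in
/-- Greedy embedding: if every vertex of `S` has at least `d` neighbours in `S`, then every tree
with at most `d + 1` vertices embeds into `S`. -/
theorem exists_tree_embedding_of_le_degree {V : Type*} [Fintype V] (G : SimpleGraph V)
    {S : Finset V} (hS : S.Nonempty) {d : ℕ}
    (hd : ∀ v ∈ S, d ≤ (S.filter fun u => G.Adj v u).card) (m : ℕ) :
    ∀ {W : Type*} [Fintype W] (T : SimpleGraph W), T.IsTree → Fintype.card W = m → m ≤ d + 1 →
      ∃ f : W → V, Function.Injective f ∧ (∀ w, f w ∈ S) ∧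
        ∀ a b, T.Adj a b → G.Adj (f a) (f b) := by
  induction m with
  | zero =>
    intro W _ T hT hW _
    have := hT.connected.nonempty
    exact absurd hW Fintype.card_ne_zero
  | succ m ih =>
    intro W _ T hT hW hm
    rcases subsingleton_or_nontrivial W with hs | hnt
    · obtain ⟨v, hv⟩ := hS
      exact ⟨fun _ => v, fun a b _ => Subsingleton.elim a b, fun _ => hv,
        fun a b hab => (hab.ne (Subsingleton.elim a b)).elim⟩
    · obtain ⟨l, hl⟩ := hT.exists_vert_degree_one_of_nontrivial
      have hT' : (T.induce {l}ᶜ).IsTree :=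
        ⟨hT.connected.induce_compl_singleton_of_degree_eq_one hl, hT.isAcyclic.induce _⟩
      have hcard : Fintype.card ({l}ᶜ : Set W) = m := by
        rw [Fintype.card_compl_set]
        simp [hW]
      obtain ⟨f, hf, hfS, hfT⟩ := ih (T.induce {l}ᶜ) hT' hcard (by omega)
      obtain ⟨p, hp, hpu⟩ := (SimpleGraph.degree_eq_one_iff_existsUnique_adj).1 hl
      have hpl : p ∈ ({l}ᶜ : Set W) := fun h => hp.ne (Set.mem_singleton_iff.1 h).symm
      have hy : ∃ y ∈ S, G.Adj (f ⟨p, hpl⟩) y ∧ ∀ w, f w ≠ y := by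
        by_contra! hcon
        have hsub : (S.filter fun u => G.Adj (f ⟨p, hpl⟩) u)
            ⊆ (Finset.univ.image f).erase (f ⟨p, hpl⟩) := by
          intro y hy
          obtain ⟨hyS, hya⟩ := Finset.mem_filter.1 hy
          obtain ⟨w, hw⟩ := hcon y hyS hya
          exact Finset.mem_erase.2 ⟨hya.ne', Finset.mem_image.2 ⟨w, Finset.mem_univ _, hw⟩⟩
        have h1 := Finset.card_le_card hsub
        rw [Finset.card_erase_of_mem (Finset.mem_image_of_mem _ (Finset.mem_univ _)),
          Finset.card_image_of_injective _ hf, Finset.card_univ, hcard] at h1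
        have h2 := hd _ (hfS ⟨p, hpl⟩)
        have h3 : 0 < m := hcard ▸ Fintype.card_pos_iff.2 ⟨⟨p, hpl⟩⟩
        omega
      obtain ⟨y, hyS, hya, hyf⟩ := hy
      refine ⟨fun w => if h : w = l then y else f ⟨w, h⟩, ?_, ?_, ?_⟩
      · intro a b hab
        by_cases ha : a = l <;> by_cases hb : b = l <;> simp only [ha, hb, dite_true, dite_false]
          at hab
        · rw [ha, hb]
        · exact (hyf _ hab.symm).elim
        · exact (hyf _ hab).elim
        · exact congrArg Subtype.val (hf hab)
      · intro w
        by_cases h : w = l <;> simp [h, hyS, hfS]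
      · intro a b hab
        by_cases ha : a = l <;> by_cases hb : b = l <;> simp only [ha, hb, dite_true, dite_false]
        · exact (hab.ne (ha.trans hb.symm)).elim
        · subst ha
          have := hpu b hab
          subst this
          exact hya.symm
        · subst hb
          have := hpu a hab.symm
          subst this
          exact hya
        · exact hfT _ _ (by simpa using hab)

open Classical in
/-- A graph without some tree on `d + 1` vertices is `(d - 1)`-degenerate, so it is sparse. -/
theorem sum_degree_le_of_not_isContained {V W : Type*} [Fintype V] [Fintype W] (G : SimpleGraph V)
    {T : SimpleGraph W} (hT : T.IsTree) {d : ℕ} (hW : Fintype.card W ≤ d + 2)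
    (hG : ¬ T.IsContained G) (S : Finset V) :
    ∑ v ∈ S, (S.filter fun u => G.Adj v u).card ≤ 2 * d * S.card := by
  induction S using Finset.strongInduction with
  | H S ih =>
    rcases S.eq_empty_or_nonempty with rfl | hS
    · simp
    -- Deleting a vertex of degree at most `d` inside `S` lowers the degree sum by twice that
    -- degree.
    have hv : ∃ v ∈ S, (S.filter fun u => G.Adj v u).card ≤ d := by
      by_contra! hcon
      obtain ⟨f, hf, -, hfT⟩ := exists_tree_embedding_of_le_degree G hS (d := d + 1)
        (fun v hv => hcon v hv) _ T hT rfl (by omega)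
      exact hG ⟨⟨⟨f, fun h => hfT _ _ h⟩, hf⟩⟩
    obtain ⟨v, hvS, hvd⟩ := hv
    have h1 := ih (S.erase v) (Finset.erase_ssubset hvS)
    have h2 : ∀ u ∈ S.erase v, (S.filter fun w => G.Adj u w).card
        = ((S.erase v).filter fun w => G.Adj u w).card + if G.Adj v u then 1 else 0 := by
      intro u hu
      rw [Finset.filter_erase]
      split_ifs with h
      · have : v ∈ S.filter fun w => G.Adj u w := Finset.mem_filter.2 ⟨hvS, h.symm⟩
        rw [Finset.card_erase_add_one this]
      · rw [Finset.erase_eq_of_notMem]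
        · rfl
        · exact fun h' => h (Finset.mem_filter.1 h').2.symm
    have h3 : ∑ u ∈ S.erase v, (if G.Adj v u then 1 else 0)
        = (S.filter fun u => G.Adj v u).card := by
      rw [← Finset.card_filter, Finset.filter_erase, Finset.erase_eq_of_notMem]
      simp
    rw [← Finset.add_sum_erase _ _ hvS, Finset.sum_congr rfl h2, Finset.sum_add_distrib, h3]
    rw [← Finset.card_erase_add_one hvS]
    linarith

/-! ### Embedding trees around a dominating set -/

/-- Embedding a graph `T` into a graph in which `D` is completely joined to `N`: the vertices of a
set `C` go to `D`, and the few edges of `T` that avoid `C` go to prescribed edges inside `N`. -/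
theorem isContained_of_join {V W : Type*} [Fintype W] {G : SimpleGraph V} {T : SimpleGraph W}
    {D N : Finset V} (hDN : ∀ d ∈ D, ∀ v ∈ N, G.Adj d v) (hN : Fintype.card W ≤ N.card)
    {C P : Finset W} (hCD : C.card ≤ D.card)
    (hC : ∀ a ∈ C, ∀ b ∈ C, T.Adj a b → ∀ d ∈ D, ∀ d' ∈ D, d ≠ d' → G.Adj d d')
    {g : W → V} (hgN : ∀ a ∈ P, g a ∈ N) (hg : Set.InjOn g P)
    (hP : ∀ a b, a ∉ C → b ∉ C → T.Adj a b → a ∈ P ∧ b ∈ P ∧ G.Adj (g a) (g b)) :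
    T.IsContained G := by
  classical
  obtain ⟨N', hPN', hN'N, hN'⟩ := Finset.exists_subsuperset_card_eq
    (s := P.image g) (t := N) (n := Fintype.card W)
    (fun v hv => by obtain ⟨a, ha, rfl⟩ := Finset.mem_image.1 hv; exact hgN a ha)
    (Finset.card_image_le.trans (Finset.card_le_univ _)) hN
  obtain ⟨e, he⟩ := Finset.exists_equiv_extend_of_card_eq (f := g) hN'.symm hPN' hg
  obtain ⟨D', hD'D, hD'⟩ := Finset.exists_subset_card_eq hCD
  let i : C ≃ D' := Finset.equivOfCardEq hD'.symm
  have hi : ∀ c, (i c : V) ∈ D := fun c => hD'D (i c).2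
  have heN : ∀ w, (e w : V) ∈ N := fun w => hN'N (e w).2
  have hdisj : ∀ v ∈ D, v ∉ N := fun v hvD hvN => (hDN v hvD v hvN).ne rfl
  let f : W → V := fun w => if h : w ∈ C then i ⟨w, h⟩ else e w
  have hf : Function.Injective f := by
    intro a b hab
    by_cases ha : a ∈ C <;> by_cases hb : b ∈ C <;>
      simp only [f, ha, hb, dite_true, dite_false] at hab
    · simpa using i.injective (Subtype.ext hab)
    · exact (hdisj _ (hi ⟨a, ha⟩) (hab ▸ heN b)).elim
    · exact (hdisj _ (hi ⟨b, hb⟩) (hab ▸ heN a)).elim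
    · exact e.injective (Subtype.ext hab)
  refine ⟨⟨⟨f, ?_⟩, hf⟩⟩
  intro a b hab
  by_cases ha : a ∈ C <;> by_cases hb : b ∈ C <;> simp only [f, ha, hb, dite_true, dite_false]
  · refine hC a ha b hb hab _ (hi _) _ (hi _) fun h => hab.ne ?_
    simpa using i.injective (Subtype.ext h)
  · exact hDN _ (hi _) _ (heN _)
  · exact (hDN _ (hi _) _ (heN _)).symm
  · obtain ⟨haP, hbP, h⟩ := hP a b ha hb hab
    rw [he a haP, he b hbP]
    exact h

-- Take the smaller class of a proper 2-colouring. Each edge has exactly one end in each class, so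
-- either degree sum counts the `|W| - 1` edges.
open Classical in
theorem SimpleGraph.IsTree.exists_bipartition {W : Type*} [Fintype W] {T : SimpleGraph W}
    (hT : T.IsTree) : ∃ A : Finset W, 2 * A.card ≤ Fintype.card W ∧
      (∀ a b, T.Adj a b → (a ∈ A ↔ b ∉ A)) ∧
      ∑ a ∈ A, T.degree a + 1 = Fintype.card W ∧ ∑ b ∈ Aᶜ, T.degree b + 1 = Fintype.card W := by
  obtain ⟨c⟩ := hT.colorable_two
  have key : ∀ A : Finset W, (∀ a b, T.Adj a b → (a ∈ A ↔ b ∉ A)) →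
      ∑ a ∈ A, T.degree a + 1 = Fintype.card W := by
    intro A hA
    have hb : T.IsBipartiteWith (A : Set W) (Aᶜ : Finset W) := by
      constructor
      · rw [Finset.disjoint_coe]
        exact disjoint_compl_right
      · intro a b hab
        have := hA a b hab
        have := hA b a hab.symm
        simp only [Finset.coe_compl, Set.mem_compl_iff, Finset.mem_coe]
        tauto
    rw [SimpleGraph.isBipartiteWith_sum_degrees_eq_card_edges hb, hT.card_edgeFinset]
  let A₀ : Finset W := Finset.univ.filter fun w => c w = 0
  have hA₀ : ∀ a b, T.Adj a b → (a ∈ A₀ ↔ b ∉ A₀) := by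
    intro a b hab
    have := c.valid hab
    simp only [A₀, Finset.mem_filter, Finset.mem_univ, true_and]
    omega
  have hA₁ : ∀ a b, T.Adj a b → (a ∈ A₀ᶜ ↔ b ∉ A₀ᶜ) := by
    intro a b hab
    have := hA₀ a b hab
    simp only [Finset.mem_compl]
    tauto
  have hcard := Finset.card_add_card_compl A₀
  rcases le_total A₀.card A₀ᶜ.card with h | h
  · exact ⟨A₀, by omega, hA₀, key _ hA₀, key _ hA₁⟩
  · exact ⟨A₀ᶜ, by omega, hA₁, key _ hA₁, by rw [compl_compl]; exact key _ hA₀⟩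

theorem isContained_of_card_bipartition_le {V W : Type*} [Fintype W] {G : SimpleGraph V}
    {T : SimpleGraph W} {D N : Finset V} (hDN : ∀ d ∈ D, ∀ v ∈ N, G.Adj d v)
    (hN : Fintype.card W ≤ N.card) {A : Finset W} (hA : ∀ a b, T.Adj a b → (a ∈ A ↔ b ∉ A))
    (hAD : A.card ≤ D.card) : T.IsContained G := by
  classical
  by_cases hW : Nonempty (W → V)
  · obtain ⟨g⟩ := hW
    refine isContained_of_join hDN hN (P := ∅) (g := g) hAD ?_ (by simp) (by simp) ?_
    · intro a ha b hb hab
      exact ((hA a b hab).1 ha hb).elim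
    · intro a b ha hb hab
      exact (ha ((hA a b hab).2 hb)).elim
  -- No map `W → V` means `V` is empty and `W` is not, contradicting the size of `N`.
  · rw [not_nonempty_iff, isEmpty_pi] at hW
    obtain ⟨w, hw⟩ := hW
    have h1 : Fintype.card W ≤ 0 := by
      rwa [Finset.eq_empty_of_isEmpty N, Finset.card_empty] at hN
    exact (Fintype.card_pos_iff.2 ⟨w⟩).not_ge h1 |>.elim

open Classical in
theorem isContained_of_dominating {V W : Type*} [Fintype V] [Fintype W] {G : SimpleGraph V}
    {T : SimpleGraph W} {D : Finset V} (hD : ∀ d ∈ D, ∀ v, v ≠ d → G.Adj d v)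
    (hV : Fintype.card W + D.card ≤ Fintype.card V)
    {C P : Finset W} (hCD : C.card ≤ D.card)
    {g : W → V} (hgN : ∀ a ∈ P, g a ∉ D) (hg : Set.InjOn g P)
    (hP : ∀ a b, a ∉ C → b ∉ C → T.Adj a b → a ∈ P ∧ b ∈ P ∧ G.Adj (g a) (g b)) :
    T.IsContained G := by
  refine isContained_of_join (N := Dᶜ) ?_ ?_ hCD ?_ (by simpa using hgN) hg hP
  · intro d hd v hv
    exact hD d hd v fun h => Finset.mem_compl.1 hv (h ▸ hd)
  · rw [Finset.card_compl]
    omega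
  · intro _ _ _ _ _ d hd d' _ hne
    exact hD d hd d' hne.symm

-- The class `A` may exceed `D` by one vertex: `a` is left out of `D`, and the only edge then
-- avoiding `D` is the one at `a`, if any; it is laid on `uv`.
open Classical in
theorem isContained_of_dominating_of_edge {V W : Type*} [Fintype V] [Fintype W]
    {G : SimpleGraph V} {T : SimpleGraph W} {D : Finset V}
    (hD : ∀ d ∈ D, ∀ v, v ≠ d → G.Adj d v) (hV : Fintype.card W + D.card ≤ Fintype.card V)
    {A : Finset W} (hA : ∀ a b, T.Adj a b → (a ∈ A ↔ b ∉ A)) (hAD : A.card ≤ D.card + 1)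
    {a : W} (haA : a ∈ A) (had : T.degree a ≤ 1) {u v : V} (hu : u ∉ D) (hv : v ∉ D)
    (huv : G.Adj u v) : T.IsContained G := by
  refine isContained_of_dominating hD hV (C := A.erase a) (P := insert a (T.neighborFinset a))
    (g := fun w => if w = a then u else v) ?_ ?_ ?_ ?_
  · rw [Finset.card_erase_of_mem haA]
    omega
  · intro w _
    split_ifs <;> assumption
  · intro x hx y hy hxy
    have := huv.ne
    have hcard := Finset.card_le_one.1 had
    simp only [Finset.coe_insert, Set.mem_insert_iff, Finset.mem_coe] at hx hy
    by_cases hxa : x = a <;> by_cases hya : y = a <;> simp [hxa, hya] at hxy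
    · rw [hxa, hya]
    · exact (this hxy).elim
    · exact (this hxy.symm).elim
    · exact hcard x (hx.resolve_left hxa) y (hy.resolve_left hya)
  · intro x y hx hy hxy
    have h1 := hA x y hxy
    simp only [Finset.mem_erase, not_and, Finset.mem_insert, SimpleGraph.mem_neighborFinset]
      at hx hy ⊢
    by_cases hxa : x = a
    · subst hxa
      simp [hxy, hxy.ne', huv]
    · have hya : y = a := by
        by_contra hya
        tauto
      subst hya
      simp [hxy.symm, hxa, huv.symm]

-- Here the vertex left out of `D` has two edges, which are laid on the path `v, u, w` with `a` at
-- the middle.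
open Classical in
theorem isContained_of_dominating_of_path {V W : Type*} [Fintype V] [Fintype W]
    {G : SimpleGraph V} {T : SimpleGraph W} {D : Finset V}
    (hD : ∀ d ∈ D, ∀ v, v ≠ d → G.Adj d v) (hV : Fintype.card W + D.card ≤ Fintype.card V)
    {A : Finset W} (hA : ∀ a b, T.Adj a b → (a ∈ A ↔ b ∉ A)) (hAD : A.card ≤ D.card + 1)
    {a : W} (haA : a ∈ A) (had : T.degree a = 2) {u v w : V} (hu : u ∉ D) (hv : v ∉ D)
    (hw : w ∉ D) (huv : G.Adj u v) (huw : G.Adj u w) (hvw : v ≠ w) : T.IsContained G := by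
  obtain ⟨b, c, hbc, hN⟩ := Finset.card_eq_two.1 had
  have hab : T.Adj a b := by
    rw [← SimpleGraph.mem_neighborFinset, hN]; simp
  have hac : T.Adj a c := by
    rw [← SimpleGraph.mem_neighborFinset, hN]; simp
  have hNa : ∀ y, T.Adj a y → y = b ∨ y = c := by
    intro y hy
    rw [← SimpleGraph.mem_neighborFinset, hN] at hy
    simpa using hy
  have hba := hab.ne'
  have hca := hac.ne'
  have hvu := huv.ne'
  have hwu := huw.ne'
  refine isContained_of_dominating hD hV (C := A.erase a) (P := {a, b, c})
    (g := fun x => if x = a then u else if x = b then v else w) ?_ ?_ ?_ ?_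
  · rw [Finset.card_erase_of_mem haA]
    omega
  · intro x _
    split_ifs <;> assumption
  · intro x hx y hy hxy
    simp only [Finset.coe_insert, Finset.coe_singleton, Set.mem_insert_iff,
      Set.mem_singleton_iff] at hx hy
    rcases hx with rfl | rfl | rfl <;> rcases hy with rfl | rfl | rfl <;>
      simp_all [Ne.symm]
  · have key : ∀ y, T.Adj a y → y ∈ ({a, b, c} : Finset W) ∧
        G.Adj u (if y = a then u else if y = b then v else w) := by
      intro y hy
      rcases hNa y hy with rfl | rfl
      · simp [hba, huv]
      · simp [hca, hbc.symm, huw]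
    intro x y hx hy hxy
    have h1 := hA x y hxy
    simp only [Finset.mem_erase, not_and] at hx hy
    by_cases hxa : x = a
    · subst hxa
      refine ⟨by simp, (key y hxy).1, ?_⟩
      simpa using (key y hxy).2
    · have hya : y = a := by
        by_contra hya
        tauto
      subst hya
      refine ⟨(key x hxy.symm).1, by simp, ?_⟩
      simpa using (key x hxy.symm).2.symm

/-- Otherwise `b, a, c` and `b, a', c` would be two different paths with the same ends. -/
theorem SimpleGraph.IsAcyclic.eq_of_adj_of_adj {W : Type*} {T : SimpleGraph W} (hT : T.IsAcyclic)
    {a a' b c : W} (hab : T.Adj b a) (hab' : T.Adj b a') (hac : T.Adj a c) (hac' : T.Adj a' c)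
    (hbc : b ≠ c) : a = a' := by
  have := hT.subsingleton_path b c
  have h := Subsingleton.elim
    (⟨.cons hab (.cons hac .nil), by simp [hab.ne, hac.ne, hbc]⟩ : T.Path b c)
    ⟨.cons hab' (.cons hac' .nil), by simp [hab'.ne, hac'.ne, hbc]⟩
  have h2 := congrArg (fun p : T.Path b c => p.1.support) h
  simpa using h2

-- An exchange: two neighbours `a`, `a'` of `b` are left out of `D` and `b` is put in, which saves
-- one place. Each of `a`, `a'` keeps a single edge avoiding `D`, to `c` and `c'`. Acyclicity makes
-- `c ≠ c'`, so the two edges are disjoint and fit on the given matching.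
open Classical in
theorem isContained_of_dominating_of_matching {V W : Type*} [Fintype V] [Fintype W]
    {G : SimpleGraph V} {T : SimpleGraph W} {D : Finset V} (hT : T.IsAcyclic)
    (hD : ∀ d ∈ D, ∀ v, v ≠ d → G.Adj d v) (hV : Fintype.card W + D.card ≤ Fintype.card V)
    {A : Finset W} (hA : ∀ a b, T.Adj a b → (a ∈ A ↔ b ∉ A)) (hAD : A.card ≤ D.card + 1)
    (had : ∀ a ∈ A, T.degree a = 2) {b : W} (hbA : b ∉ A) (hb : 2 ≤ T.degree b) {u v u' v' : V}
    (hu : u ∉ D) (hv : v ∉ D) (hu' : u' ∉ D) (hv' : v' ∉ D) (huv : G.Adj u v)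
    (huv' : G.Adj u' v') (huu' : u ≠ u') (huv₂ : u ≠ v') (hvu : v ≠ u') (hvv : v ≠ v') :
    T.IsContained G := by
  obtain ⟨a, ha, a', ha', haa⟩ := Finset.one_lt_card.1 (show 1 < (T.neighborFinset b).card from hb)
  rw [SimpleGraph.mem_neighborFinset] at ha ha'
  have haA : a ∈ A := (hA a b ha.symm).2 hbA
  have haA' : a' ∈ A := (hA a' b ha'.symm).2 hbA
  have hnb : ∀ x ∈ A, T.Adj b x → ∃ c, c ≠ b ∧ c ∉ A ∧ T.Adj x c ∧
      ∀ y, T.Adj x y → y = b ∨ y = c := by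
    intro x hx hbx
    have h1 : ((T.neighborFinset x).erase b).card = 1 := by
      have := had x hx
      rw [Finset.card_erase_of_mem (by simpa using hbx.symm), SimpleGraph.card_neighborFinset_eq_degree,
        this]
    obtain ⟨c, hc⟩ := Finset.card_eq_one.1 h1
    have hc' : c ∈ (T.neighborFinset x).erase b := by rw [hc]; simp
    rw [Finset.mem_erase, SimpleGraph.mem_neighborFinset] at hc'
    refine ⟨c, hc'.1, (hA x c hc'.2).1 hx, hc'.2, fun y hy => ?_⟩
    by_contra! hcon
    have : y ∈ (T.neighborFinset x).erase b :=
      Finset.mem_erase.2 ⟨hcon.1, by simpa using hy⟩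
    rw [hc, Finset.mem_singleton] at this
    exact hcon.2 this
  obtain ⟨c, hcb, hcA, hac, hNa⟩ := hnb a haA ha
  obtain ⟨c', hcb', hcA', hac', hNa'⟩ := hnb a' haA' ha'
  have hcc : c ≠ c' := by
    rintro rfl
    exact haa (hT.eq_of_adj_of_adj ha ha' hac hac' hcb.symm)
  have h1 : a ≠ c := fun h => hcA (h ▸ haA)
  have h2 : a ≠ c' := fun h => hcA' (h ▸ haA)
  have h3 : a' ≠ c := fun h => hcA (h ▸ haA')
  have h4 : a' ≠ c' := fun h => hcA' (h ▸ haA')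
  have h5 := huv.ne
  have h6 := huv'.ne
  refine isContained_of_dominating hD hV (C := insert b ((A.erase a).erase a'))
    (P := {a, c, a', c'})
    (g := fun x => if x = a then u else if x = c then v else if x = a' then u' else v')
    ?_ ?_ ?_ ?_
  · refine (Finset.card_insert_le _ _).trans ?_
    have h7 : a' ∈ A.erase a := Finset.mem_erase.2 ⟨haa.symm, haA'⟩
    have h8 := Finset.card_erase_add_one h7
    have h9 := Finset.card_erase_add_one haA
    omega
  · intro x _
    split_ifs <;> assumption
  · intro x hx y hy hxy
    simp only [Finset.coe_insert, Finset.coe_singleton, Set.mem_insert_iff,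
      Set.mem_singleton_iff] at hx hy
    clear hA hNa hNa' hnb had hD hV hAD
    rcases hx with rfl | rfl | rfl | rfl <;> rcases hy with rfl | rfl | rfl | rfl <;>
      simp_all [Ne.symm, eq_comm]
  · have key : ∀ x y, x ∈ A → x ∉ insert b ((A.erase a).erase a') →
        y ∉ insert b ((A.erase a).erase a') → T.Adj x y →
        x ∈ ({a, c, a', c'} : Finset W) ∧ y ∈ ({a, c, a', c'} : Finset W) ∧
        G.Adj (if x = a then u else if x = c then v else if x = a' then u' else v')
          (if y = a then u else if y = c then v else if y = a' then u' else v') := by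
      intro x y hxA hx hy hxy
      simp only [Finset.mem_insert, Finset.mem_erase, not_or] at hx hy
      by_cases hxa : x = a
      · subst hxa
        obtain rfl := (hNa y hxy).resolve_left hy.1
        simp [h1.symm, huv]
      · have hxa' : x = a' := by
          by_contra hxa'
          tauto
        subst hxa'
        obtain rfl := (hNa' y hxy).resolve_left hy.1
        simp [h2.symm, h3, h4.symm, haa.symm, hcc.symm, huv']
    intro x y hx hy hxy
    by_cases hxA : x ∈ A
    · exact key x y hxA hx hy hxy
    · have hyA : y ∈ A := by
        have := hA x y hxy
        tauto
      obtain ⟨k1, k2, k3⟩ := key y x hyA hy hx hxy.symm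
      exact ⟨k2, k1, k3.symm⟩

theorem containsAllTrees_of_join {V : Type*} {G : SimpleGraph V} {k m : ℕ} (hm : m ≤ 2 * k + 1)
    {D N : Finset V} (hDN : ∀ d ∈ D, ∀ v ∈ N, G.Adj d v) (hN : m ≤ N.card) (hD : k ≤ D.card) :
    ContainsAllTrees G m := by
  intro T hT
  obtain ⟨A, hA, hAb, -⟩ := hT.exists_bipartition
  rw [Fintype.card_fin] at hA
  exact isContained_of_card_bipartition_le hDN (by simpa using hN) hAb (by omega)

/-- The smaller colour class `A` has at most `k + 1` vertices. Either it contains a leaf, which can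
be left out of `D`, or `2|A| ≤ 2k + 1` and `A` fits into `D`. -/
theorem containsAllTrees_of_dominating_of_edge {V : Type*} [Fintype V] {G : SimpleGraph V}
    {k : ℕ} {D : Finset V} (hD : ∀ d ∈ D, ∀ v, v ≠ d → G.Adj d v) (hDk : D.card = k)
    (hV : 3 * k + 2 ≤ Fintype.card V) {u v : V} (hu : u ∉ D) (hv : v ∉ D) (huv : G.Adj u v) :
    ContainsAllTrees G (2 * k + 2) := by
  classical
  intro T hT
  have hW : Fintype.card (Fin (2 * k + 2)) = 2 * k + 2 := Fintype.card_fin _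
  obtain ⟨A, hA, hAb, hsum, -⟩ := hT.exists_bipartition
  rw [hW] at hA hsum
  by_cases h : ∃ a ∈ A, T.degree a ≤ 1
  · obtain ⟨a, haA, had⟩ := h
    exact isContained_of_dominating_of_edge hD (by omega) hAb (by omega) haA (by convert had)
      hu hv huv
  · push Not at h
    have h1 : ∑ a ∈ A, 2 ≤ ∑ a ∈ A, T.degree a := Finset.sum_le_sum fun a ha => h a ha
    have h2 : ∑ a ∈ A, T.degree a + 1 = 2 * k + 2 := by convert hsum
    rw [Finset.sum_const, smul_eq_mul] at h1
    refine isContained_of_card_bipartition_le (D := D) (N := Dᶜ) ?_ ?_ hAb (by omega)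
    · exact fun d hd v hv => hD d hd v fun h => Finset.mem_compl.1 hv (h ▸ hd)
    · rw [Finset.card_compl]
      omega

/-- The critical case is `|A| = k + 1` without leaves in `A`: the degree sum `2k + 2` then makes
every degree in `A` equal to 2. Two edges that share an end form the path needed for one vertex of
`A`; two disjoint edges serve the exchange argument. -/
theorem containsAllTrees_of_dominating_of_two_edges {V : Type*} [Fintype V] {G : SimpleGraph V}
    {k : ℕ} (hk : 1 ≤ k) {D : Finset V} (hD : ∀ d ∈ D, ∀ v, v ≠ d → G.Adj d v) (hDk : D.card = k)
    (hV : 3 * k + 3 ≤ Fintype.card V) {u v u' v' : V} (hu : u ∉ D) (hv : v ∉ D) (hu' : u' ∉ D)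
    (hv' : v' ∉ D) (huv : G.Adj u v) (huv' : G.Adj u' v') (hne : s(u, v) ≠ s(u', v')) :
    ContainsAllTrees G (2 * k + 3) := by
  classical
  intro T hT
  have hW : Fintype.card (Fin (2 * k + 3)) = 2 * k + 3 := Fintype.card_fin _
  have hVW : Fintype.card (Fin (2 * k + 3)) + D.card ≤ Fintype.card V := by omega
  obtain ⟨A, hA, hAb, hsum, hsum'⟩ := hT.exists_bipartition
  rw [hW] at hA hsum hsum'
  have hsum₁ : ∑ a ∈ A, T.degree a + 1 = 2 * k + 3 := by convert hsum
  have hsum₂ : ∑ a ∈ Aᶜ, T.degree a + 1 = 2 * k + 3 := by convert hsum'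
  rcases Nat.lt_or_ge k A.card with hkA | hkA
  swap
  · refine isContained_of_card_bipartition_le (D := D) (N := Dᶜ) ?_ ?_ hAb (by omega)
    · exact fun d hd v hv => hD d hd v fun h => Finset.mem_compl.1 hv (h ▸ hd)
    · rw [Finset.card_compl]
      omega
  have hAk : A.card = k + 1 := by omega
  by_cases h : ∃ a ∈ A, T.degree a ≤ 1
  · obtain ⟨a, haA, had⟩ := h
    exact isContained_of_dominating_of_edge hD hVW hAb (by omega) haA (by convert had) hu hv huv
  push Not at h
  have hdeg : ∀ a ∈ A, 2 = T.degree a := by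
    refine (Finset.sum_eq_sum_iff_of_le fun a ha => h a ha).1 ?_
    rw [Finset.sum_const, smul_eq_mul]
    omega
  have hAne : A.Nonempty := Finset.card_pos.1 (by omega)
  obtain ⟨a, haA⟩ := hAne
  have path : ∀ {x y z : V}, x ∉ D → y ∉ D → z ∉ D → G.Adj x y → G.Adj x z → y ≠ z →
      T.IsContained G := fun hx hy hz hxy hxz hyz =>
    isContained_of_dominating_of_path hD hVW hAb (by omega) haA
      (by have := (hdeg a haA).symm; convert this) hx hy hz hxy hxz hyz
  rw [Ne, Sym2.eq_iff, not_or, not_and, not_and] at hne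
  by_cases h1 : u = u'
  · subst h1
    exact path hu hv hv' huv huv' (hne.1 rfl)
  by_cases h2 : u = v'
  · subst h2
    exact path hu hv hu' huv huv'.symm (hne.2 rfl)
  by_cases h3 : v = u'
  · subst h3
    exact path hv hu hv' huv.symm huv' h2
  by_cases h4 : v = v'
  · subst h4
    exact path hv hu hu' huv.symm huv'.symm h1
  -- The other class has `k + 2` vertices and degree sum `2k + 2`, which exceeds `k + 2` because `k
  -- ≥ 1`.
  obtain ⟨b, hbA, hb⟩ : ∃ b ∈ Aᶜ, 2 ≤ T.degree b := by
    by_contra! hcon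
    have h5 : ∑ b ∈ Aᶜ, T.degree b ≤ ∑ b ∈ Aᶜ, 1 :=
      Finset.sum_le_sum fun b hb => Nat.le_of_lt_succ (hcon b hb)
    rw [Finset.sum_const, smul_eq_mul, Finset.card_compl, hW] at h5
    omega
  refine isContained_of_dominating_of_matching hT.isAcyclic hD hVW hAb (by omega)
    (fun a ha => ?_) (Finset.mem_compl.1 hbA) (by convert hb) hu hv hu' hv' huv huv' h1 h2 h3 h4
  have := (hdeg a ha).symm
  convert this

/-! ### Paths missing from the extremal graphs -/

theorem isTree_pathGraph (m : ℕ) : (SimpleGraph.pathGraph (m + 1)).IsTree := by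
  classical
  rw [SimpleGraph.isTree_iff_connected_and_card]
  have hc := SimpleGraph.pathGraph_connected m
  refine ⟨hc, le_antisymm ?_ hc.card_vert_le_card_edgeSet_add_one⟩
  have hsub : (SimpleGraph.pathGraph (m + 1)).edgeSet
      ⊆ Set.range fun i : Fin m => s(i.castSucc, i.succ) := by
    intro e
    induction e with
    | h a b =>
      intro hab
      rw [SimpleGraph.mem_edgeSet, SimpleGraph.pathGraph_adj] at hab
      rcases hab with h | h
      · exact ⟨⟨a, by omega⟩, congrArg₂ (fun x y => s(x, y)) (Fin.ext rfl) (Fin.ext h)⟩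
      · refine ⟨⟨b, by omega⟩, ?_⟩
        rw [Sym2.eq_swap]
        exact congrArg₂ (fun x y => s(x, y)) (Fin.ext rfl) (Fin.ext h)
  have h1 := Nat.card_mono (Set.finite_range _) hsub
  have h2 := Finite.card_range_le fun i : Fin m => s(i.castSucc, i.succ)
  rw [Nat.card_fin] at h2 ⊢
  omega

/-- Each vertex of `D` is the first end of at most one of the `m` consecutive pairs and the second
end of at most one, so it meets at most two of them. -/
theorem exists_finset_of_injective {V : Type*} {m : ℕ} {f : Fin (m + 1) → V}
    (hf : Function.Injective f) (D : Finset V) :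
    ∃ B : Finset (Fin m), m ≤ 2 * D.card + B.card ∧ ∀ i ∈ B, f i.castSucc ∉ D ∧ f i.succ ∉ D := by
  classical
  refine ⟨Finset.univ.filter fun i : Fin m => f i.castSucc ∉ D ∧ f i.succ ∉ D, ?_, by simp⟩
  have h1 : (Finset.univ.filter fun i : Fin m => f i.castSucc ∈ D).card ≤ D.card :=
    Finset.card_le_card_of_injOn (fun i => f i.castSucc) (fun i hi => by simpa using hi)
      (fun i _ j _ hij => Fin.castSucc_injective _ (hf hij))
  have h2 : (Finset.univ.filter fun i : Fin m => f i.succ ∈ D).card ≤ D.card :=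
    Finset.card_le_card_of_injOn (fun i => f i.succ) (fun i hi => by simpa using hi)
      (fun i _ j _ hij => Fin.succ_injective _ (hf hij))
  have h3 : (Finset.univ : Finset (Fin m)) ⊆ ((Finset.univ.filter fun i : Fin m => f i.castSucc ∈ D)
      ∪ (Finset.univ.filter fun i : Fin m => f i.succ ∈ D))
      ∪ (Finset.univ.filter fun i : Fin m => f i.castSucc ∉ D ∧ f i.succ ∉ D) := by
    intro i _
    simp only [Finset.mem_union, Finset.mem_filter, Finset.mem_univ, true_and]
    tauto
  have h4 := (Finset.card_le_card h3).trans (Finset.card_union_le _ _)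
  have h5 := Finset.card_union_le (Finset.univ.filter fun i : Fin m => f i.castSucc ∈ D)
      (Finset.univ.filter fun i : Fin m => f i.succ ∈ D)
  rw [Finset.card_univ, Fintype.card_fin] at h4
  omega

theorem pathGraph_adj_castSucc_succ {m : ℕ} (i : Fin m) :
    (SimpleGraph.pathGraph (m + 1)).Adj i.castSucc i.succ := by
  rw [SimpleGraph.pathGraph_adj]
  simp

theorem card_inl_image (k m : ℕ) :
    (Finset.univ.map (Function.Embedding.inl : Fin k ↪ Fin k ⊕ Fin m)).card = k := by
  simp

theorem not_containsAllTrees_graphS (n k : ℕ) : ¬ ContainsAllTrees (graphS n k) (2 * k + 2) := by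
  classical
  intro h
  obtain ⟨⟨f, hf⟩⟩ := h _ (isTree_pathGraph (2 * k + 1))
  obtain ⟨B, h1, hB⟩ := exists_finset_of_injective hf
    (Finset.univ.map (Function.Embedding.inl : Fin k ↪ Fin k ⊕ Fin (n - k)))
  have hB0 : B = ∅ := Finset.eq_empty_of_forall_notMem fun i hiB => by
    have hi := hB i hiB
    have hadj := f.map_adj (pathGraph_adj_castSucc_succ i)
    change (graphS n k).Adj (f i.castSucc) (f i.succ) at hadj
    change f i.castSucc ∉ _ ∧ f i.succ ∉ _ at hi
    generalize f i.castSucc = a at hi hadj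
    generalize f i.succ = b at hi hadj
    rcases a with a | a <;> rcases b with b | b <;> simp at hi hadj
  rw [card_inl_image, hB0, Finset.card_empty] at h1
  omega

theorem not_containsAllTrees_graphSPlus (n k : ℕ) :
    ¬ ContainsAllTrees (graphSPlus n k) (2 * k + 3) := by
  classical
  intro h
  obtain ⟨⟨f, hf⟩⟩ := h _ (isTree_pathGraph (2 * k + 2))
  obtain ⟨B, h1, hB⟩ := exists_finset_of_injective hf
    (Finset.univ.map (Function.Embedding.inl : Fin k ↪ Fin k ⊕ Fin (n - k)))
  rw [card_inl_image] at h1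
  have key : ∀ i : Fin (2 * k + 2),
      f i.castSucc ∉ Finset.univ.map (Function.Embedding.inl : Fin k ↪ Fin k ⊕ Fin (n - k)) ∧
      f i.succ ∉ Finset.univ.map (Function.Embedding.inl : Fin k ↪ Fin k ⊕ Fin (n - k)) →
      ∃ a b, f i.castSucc = Sum.inr a ∧ f i.succ = Sum.inr b ∧
        (a.val = 0 ∧ b.val = 1 ∨ b.val = 0 ∧ a.val = 1) := by
    intro i hi
    have hadj := f.map_adj (pathGraph_adj_castSucc_succ i)
    change (graphSPlus n k).Adj (f i.castSucc) (f i.succ) at hadj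
    generalize f i.castSucc = a at hi hadj ⊢
    generalize f i.succ = b at hi hadj ⊢
    rcases a with a | a <;> rcases b with b | b <;> simp at hi hadj
    exact ⟨a, b, rfl, rfl, hadj⟩
  have h2 : B.card ≤ 1 := by
    rw [Finset.card_le_one]
    intro i hi j hj
    obtain ⟨a, b, ha, hb, hab⟩ := key i (hB i hi)
    obtain ⟨a', b', ha', hb', hab'⟩ := key j (hB j hj)
    by_cases haa : a = a'
    · exact Fin.castSucc_injective _ (hf (ha.trans (haa ▸ ha'.symm)))
    -- The two steps traverse the same edge in opposite directions, which would give both `i = j +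
    -- 1` and `i + 1 = j`.
    · have e1 : i.castSucc = j.succ := hf (ha.trans ((by
        rw [show a = b' by ext; have := Fin.val_ne_of_ne haa; omega]
        exact hb'.symm)))
      have e2 : i.succ = j.castSucc := hf (hb.trans ((by
        rw [show b = a' by ext; have := Fin.val_ne_of_ne haa; omega]
        exact ha'.symm)))
      have e1' := congrArg Fin.val e1
      have e2' := congrArg Fin.val e2
      simp at e1' e2'
      omega
  omega

/-! ### Recognising the extremal graphs -/

theorem exists_equiv_sum_fin {V : Type*} [Fintype V] {n k : ℕ} (hV : Fintype.card V = n)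
    {D : Finset V} (hD : D.card = k) :
    ∃ e : V ≃ Fin k ⊕ Fin (n - k), (∀ v ∈ D, ∃ i, e v = Sum.inl i) ∧
      ∀ v ∉ D, ∃ j, e v = Sum.inr j := by
  classical
  let e₁ : {v // v ∈ D} ≃ Fin k := Fintype.equivFinOfCardEq (by simpa using hD)
  let e₂ : {v // v ∉ D} ≃ Fin (n - k) := Fintype.equivFinOfCardEq (by
    rw [Fintype.card_subtype_compl, hV]
    simp [hD])
  refine ⟨(Equiv.sumCompl (· ∈ D)).symm.trans (Equiv.sumCongr e₁ e₂), ?_, ?_⟩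
  · intro v hv
    exact ⟨e₁ ⟨v, hv⟩, by simp [Equiv.sumCompl_symm_apply_of_pos hv]⟩
  · intro v hv
    exact ⟨e₂ ⟨v, hv⟩, by simp [Equiv.sumCompl_symm_apply_of_neg hv]⟩

theorem exists_equiv_sum_fin_of_ne {V : Type*} [Fintype V] {n k : ℕ} (hV : Fintype.card V = n)
    {D : Finset V} (hD : D.card = k) {u v : V} (hu : u ∉ D) (hv : v ∉ D) (huv : u ≠ v) :
    ∃ e : V ≃ Fin k ⊕ Fin (n - k), (∀ w ∈ D, ∃ i, e w = Sum.inl i) ∧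
      (∀ w ∉ D, ∃ j, e w = Sum.inr j) ∧ (∃ j, e u = Sum.inr j ∧ j.val = 0) ∧
      ∃ j, e v = Sum.inr j ∧ j.val = 1 := by
  obtain ⟨e, heD, heN⟩ := exists_equiv_sum_fin hV hD
  obtain ⟨i, hi⟩ := heN u hu
  obtain ⟨j, hj⟩ := heN v hv
  have hij : i ≠ j := by
    rintro rfl
    exact huv (e.injective (hi.trans hj.symm))
  have h2 : 2 ≤ n - k := by
    have h1 := i.2
    have h2 := j.2
    have h3 := Fin.val_ne_of_ne hij
    omega
  let z : Fin (n - k) := ⟨0, by omega⟩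
  let o : Fin (n - k) := ⟨1, by omega⟩
  have hzo : z ≠ o := by simp [z, o]
  -- The first swap sends `i` to 0; the second sends the image of `j` to 1 and leaves 0 alone.
  let σ : Equiv.Perm (Fin (n - k)) := (Equiv.swap i z).trans (Equiv.swap (Equiv.swap i z j) o)
  have hσi : σ i = z := by
    have : Equiv.swap i z j ≠ z := by
      intro h
      exact hij ((Equiv.swap i z).injective ((Equiv.swap_apply_left i z).trans h.symm))
    simp [σ, Equiv.swap_apply_of_ne_of_ne this.symm hzo]
  have hσj : σ j = o := by simp [σ]
  refine ⟨e.trans (Equiv.sumCongr (Equiv.refl _) σ), ?_, ?_, ⟨z, ?_, rfl⟩, ⟨o, ?_, rfl⟩⟩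
  · intro w hw
    obtain ⟨a, ha⟩ := heD w hw
    exact ⟨a, by simp [ha]⟩
  · intro w hw
    obtain ⟨a, ha⟩ := heN w hw
    exact ⟨σ a, by simp [ha]⟩
  · simp [hi, hσi]
  · simp [hj, hσj]

theorem nonempty_iso_graphS {V : Type*} [Fintype V] {G : SimpleGraph V} {n k : ℕ}
    (hV : Fintype.card V = n) {D : Finset V} (hDk : D.card = k)
    (hD : ∀ d ∈ D, ∀ v, v ≠ d → G.Adj d v) (h : ∀ u ∉ D, ∀ v ∉ D, ¬ G.Adj u v) :
    Nonempty (G ≃g graphS n k) := by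
  obtain ⟨e, heD, heN⟩ := exists_equiv_sum_fin hV hDk
  refine ⟨⟨e, fun {a b} => ?_⟩⟩
  by_cases ha : a ∈ D
  · obtain ⟨i, hi⟩ := heD a ha
    have h1 : G.Adj a b ↔ a ≠ b := ⟨fun h => h.ne, fun h => hD a ha b h.symm⟩
    by_cases hb : b ∈ D
    · obtain ⟨j, hj⟩ := heD b hb
      rw [h1, ← e.injective.ne_iff, hi, hj]
      simp
    · obtain ⟨j, hj⟩ := heN b hb
      rw [h1, hi, hj]
      simpa using fun h : a = b => hb (h ▸ ha)
  · obtain ⟨i, hi⟩ := heN a ha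
    by_cases hb : b ∈ D
    · obtain ⟨j, hj⟩ := heD b hb
      rw [hi, hj]
      simpa using (hD b hb a fun h => ha (h ▸ hb)).symm
    · obtain ⟨j, hj⟩ := heN b hb
      rw [hi, hj]
      simpa using h a ha b hb

theorem nonempty_iso_graphSPlus {V : Type*} [Fintype V] {G : SimpleGraph V} {n k : ℕ}
    (hV : Fintype.card V = n) {D : Finset V} (hDk : D.card = k)
    (hD : ∀ d ∈ D, ∀ v, v ≠ d → G.Adj d v) {u v : V} (hu : u ∉ D) (hv : v ∉ D) (huv : G.Adj u v)
    (h : ∀ a ∉ D, ∀ b ∉ D, G.Adj a b → s(a, b) = s(u, v)) :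
    Nonempty (G ≃g graphSPlus n k) := by
  obtain ⟨e, heD, heN, ⟨z, hz, hz0⟩, ⟨o, ho, ho1⟩⟩ :=
    exists_equiv_sum_fin_of_ne hV hDk hu hv huv.ne
  refine ⟨⟨e, fun {a b} => ?_⟩⟩
  by_cases ha : a ∈ D
  · obtain ⟨i, hi⟩ := heD a ha
    have h1 : G.Adj a b ↔ a ≠ b := ⟨fun h => h.ne, fun h => hD a ha b h.symm⟩
    by_cases hb : b ∈ D
    · obtain ⟨j, hj⟩ := heD b hb
      rw [h1, ← e.injective.ne_iff, hi, hj]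
      simp
    · obtain ⟨j, hj⟩ := heN b hb
      rw [h1, hi, hj]
      simpa using fun h : a = b => hb (h ▸ ha)
  · obtain ⟨i, hi⟩ := heN a ha
    by_cases hb : b ∈ D
    · obtain ⟨j, hj⟩ := heD b hb
      rw [hi, hj]
      simpa using (hD b hb a fun h => ha (h ▸ hb)).symm
    · obtain ⟨j, hj⟩ := heN b hb
      have hau : a = u ↔ i.val = 0 := by
        rw [← e.injective.eq_iff, hi, hz, Sum.inr.injEq, Fin.ext_iff, hz0]
      have hav : a = v ↔ i.val = 1 := by
        rw [← e.injective.eq_iff, hi, ho, Sum.inr.injEq, Fin.ext_iff, ho1]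
      have hbu : b = u ↔ j.val = 0 := by
        rw [← e.injective.eq_iff, hj, hz, Sum.inr.injEq, Fin.ext_iff, hz0]
      have hbv : b = v ↔ j.val = 1 := by
        rw [← e.injective.eq_iff, hj, ho, Sum.inr.injEq, Fin.ext_iff, ho1]
      rw [hi, hj, graphSPlus_adj_inr_inr, ← hau, ← hav, ← hbu, ← hbv]
      constructor
      · rintro (⟨rfl, rfl⟩ | ⟨rfl, rfl⟩)
        · exact huv
        · exact huv.symm
      · intro hab
        have := Sym2.eq_iff.1 (h a ha b hb hab)
        tauto

/-! ### From large `q` to `k` dominating vertices -/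

open Classical in
theorem exists_eigenvector_max_eq_one {V : Type*} [Fintype V] [Nonempty V] (G : SimpleGraph V) :
    ∃ x : V → ℝ, (∀ v, 0 ≤ x v) ∧ (∀ v, x v ≤ 1) ∧ (∃ z, x z = 1) ∧
      ∀ v, signlessRadius G * x v
        = (Finset.univ.filter fun u => G.Adj v u).card * x v
          + ∑ u, if G.Adj v u then x u else 0 := by
  obtain ⟨y, hy0, ⟨w, hw⟩, hy, -⟩ := exists_nonneg_eigenvector G
  obtain ⟨z, hz⟩ := Finite.exists_max y
  have hz0 : 0 < y z := hw.trans_le (hz w)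
  refine ⟨fun v => y v / y z, fun v => div_nonneg (hy0 v) hz0.le,
    fun v => (div_le_one hz0).2 (hz v), ⟨z, div_self hz0.ne'⟩, fun v => ?_⟩
  have h1 : ∀ u, (if G.Adj v u then y v + y u else 0)
      = (if G.Adj v u then y v else 0) + if G.Adj v u then y u else 0 := by
    intro u
    split_ifs <;> simp
  have h2 := hy v
  simp only [h1, Finset.sum_add_distrib] at h2
  rw [← Finset.sum_filter, Finset.sum_const, nsmul_eq_mul] at h2
  have h3 : (∑ u, if G.Adj v u then y u / y z else 0)
      = (∑ u, if G.Adj v u then y u else 0) / y z := by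
    rw [Finset.sum_div]
    refine Finset.sum_congr rfl fun u _ => ?_
    split_ifs <;> simp
  rw [h3]
  field_simp
  linarith

open Classical in
/-- Few vertices can have degree close to the order of a graph that misses a tree. -/
theorem card_filter_le_degree_le {V : Type*} [Fintype V] {G : SimpleGraph V} {k n m : ℕ}
    (hk : 1 ≤ k) (hn : 10 * k ≤ n) (hV : Fintype.card V = n) (hm : m ≤ 2 * k + 3)
    (hG : ¬ ContainsAllTrees G m) :
    (Finset.univ.filter fun v =>
      (n : ℝ) - n / (4 * k) ≤ (Finset.univ.filter fun u => G.Adj v u).card).card ≤ k := by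
  by_contra! hcon
  obtain ⟨D, hDsub, hD⟩ := Finset.exists_subset_card_eq (Nat.succ_le_of_lt hcon)
  let N : Finset V := Finset.univ.filter fun v => ∀ d ∈ D, G.Adj d v
  apply hG
  refine containsAllTrees_of_join (k := k + 1) (N := N) (by omega)
    (fun d hd v hv => (Finset.mem_filter.1 hv).2 d hd) ?_ hD.ge
  have h1 : Nᶜ ⊆ D.biUnion fun d => (Finset.univ.filter fun u => G.Adj d u)ᶜ := by
    intro v hv
    simp only [N, Finset.mem_compl, Finset.mem_filter, Finset.mem_univ, true_and, not_forall] at hv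
    obtain ⟨d, hd, h⟩ := hv
    exact Finset.mem_biUnion.2 ⟨d, hd, by simpa using h⟩
  have h2 := (Finset.card_le_card h1).trans Finset.card_biUnion_le
  have hk0 : (1 : ℝ) ≤ k := by exact_mod_cast hk
  have h3 : ∀ d ∈ D, (((Finset.univ.filter fun u => G.Adj d u)ᶜ.card : ℕ) : ℝ) ≤ n / (4 * k) := by
    intro d hd
    have h := (Finset.mem_filter.1 (hDsub hd)).2
    rw [Finset.card_compl, Nat.cast_sub (Finset.card_le_univ _), hV]
    linarith
  have h4 : (Nᶜ.card : ℝ) ≤ (k + 1) * (n / (4 * k)) := by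
    calc (Nᶜ.card : ℝ) ≤ ∑ d ∈ D, (((Finset.univ.filter fun u => G.Adj d u)ᶜ.card : ℕ) : ℝ) := by
          exact_mod_cast h2
      _ ≤ ∑ d ∈ D, (n : ℝ) / (4 * k) := Finset.sum_le_sum h3
      _ = (k + 1) * (n / (4 * k)) := by
          rw [Finset.sum_const, hD, nsmul_eq_mul]
          push_cast
          ring
  -- The `k + 1` vertices together miss at most half of the graph, so at least `n / 2 ≥ 5k ≥ 2k + 3`
  -- common neighbours remain.
  have h5 : ((k : ℝ) + 1) * (n / (4 * k)) ≤ n / 2 := by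
    have : (0 : ℝ) ≤ n := Nat.cast_nonneg n
    rw [← mul_div_assoc, div_le_div_iff₀ (by positivity) (by norm_num)]
    nlinarith
  have h6 := Finset.card_add_card_compl N
  rw [hV] at h6
  have h7 : 2 * Nᶜ.card ≤ n := by
    have : 2 * (Nᶜ.card : ℝ) ≤ n := by linarith
    exact_mod_cast this
  omega

/-- The numerical core: total weight of an eigenvector in terms of its weight on `D`. -/
theorem weight_le_of_eigenvector {V : Type*} [Fintype V] [DecidableEq V] {x δ : V → ℝ}
    {q K N : ℝ} (hK : 1 ≤ K) (hN : 256000 * K ^ 8 ≤ N) (hx : ∀ v, 0 ≤ x v)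
    (hδ : ∀ v, 0 ≤ δ v) (hδN : ∀ v, δ v ≤ N - 1) (hq : N + 2 * K - 2 - 3 * K ^ 2 / N ≤ q)
    (hδsum : ∑ v, δ v ≤ 6 * K * N) (hsum : ∑ v, (q - 2 * δ v) * x v = 0)
    (hle : ∀ v, (q - δ v + 1) * x v ≤ ∑ u, x u) {D : Finset V}
    (hD : ∀ v, v ∉ D → δ v ≤ N - N / (4 * K)) :
    (1 - 1 / (16 * K ^ 2)) * ∑ v, x v ≤ 2 * ∑ v ∈ D, x v := by
  classical
  have hK0 : 0 < K := by linarith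
  have hK4 : K ^ 4 ≤ K ^ 8 := pow_le_pow_right₀ hK (by norm_num)
  have hK2 : K ^ 2 ≤ K ^ 8 := pow_le_pow_right₀ hK (by norm_num)
  have hK6 : K ^ 6 ≤ K ^ 8 := pow_le_pow_right₀ hK (by norm_num)
  have hK8 : 1 ≤ K ^ 8 := one_le_pow₀ hK
  have hN0 : 0 < N := by linarith
  have hε : 3 * K ^ 2 / N ≤ 1 := by
    rw [div_le_one hN0]
    linarith
  set S := ∑ v, x v with hS
  have hS0 : 0 ≤ S := Finset.sum_nonneg fun v _ => hx v
  have hsmall : ∀ v, v ∉ D → x v ≤ 4 * K * S / N := by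
    intro v hv
    have h1 := hle v
    have h2 : N / (4 * K) ≤ q - δ v + 1 := by
      have := hD v hv
      linarith
    have h3 : N / (4 * K) * x v ≤ S := (mul_le_mul_of_nonneg_right h2 (hx v)).trans h1
    rw [le_div_iff₀ hN0]
    rw [div_mul_eq_mul_div, div_le_iff₀ (by positivity)] at h3
    linarith
  -- The exceptional vertices of intermediate degree: few by the degree sum, and each with a small
  -- entry by `hsmall`.
  let L : Finset V := Finset.univ.filter fun v => v ∉ D ∧ N / (60 * K ^ 2) < δ v
  have hLcard : (L.card : ℝ) ≤ 360 * K ^ 3 := by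
    have h1 : (L.card : ℝ) * (N / (60 * K ^ 2)) ≤ 6 * K * N := by
      calc (L.card : ℝ) * (N / (60 * K ^ 2)) = ∑ v ∈ L, N / (60 * K ^ 2) := by
            rw [Finset.sum_const, nsmul_eq_mul]
        _ ≤ ∑ v ∈ L, δ v := Finset.sum_le_sum fun v hv => (Finset.mem_filter.1 hv).2.2.le
        _ ≤ ∑ v, δ v := Finset.sum_le_sum_of_subset_of_nonneg (Finset.subset_univ _)
            fun v _ _ => hδ v
        _ ≤ _ := hδsum
    rw [← mul_div_assoc, div_le_iff₀ (by positivity)] at h1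
    refine le_of_mul_le_mul_right ?_ hN0
    linarith
  have hLsum : ∑ v ∈ L, x v ≤ 1440 * K ^ 4 * S / N := by
    calc ∑ v ∈ L, x v ≤ ∑ v ∈ L, 4 * K * S / N :=
          Finset.sum_le_sum fun v hv => hsmall v (Finset.mem_filter.1 hv).2.1
      _ = L.card * (4 * K * S / N) := by rw [Finset.sum_const, nsmul_eq_mul]
      _ ≤ 360 * K ^ 3 * (4 * K * S / N) := mul_le_mul_of_nonneg_right hLcard (by positivity)
      _ = 1440 * K ^ 4 * S / N := by ring
  -- Outside `D` and `L` the loss is at most three times `N / (60 K²)`: two from `2 δ v` and one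
  -- from `3 K² / N`. On `D` and `L` the trivial `δ v ≤ N - 1` costs at most `2 N`.
  have hpoint : ∀ v, N * (1 - 1 / (20 * K ^ 2)) * x v - 2 * N * (if v ∈ D then x v else 0)
      - 2 * N * (if v ∈ L then x v else 0) ≤ (q - 2 * δ v) * x v := by
    intro v
    have hc : 0 ≤ N * (1 / (20 * K ^ 2)) := by positivity
    have h1 : N * (1 - 1 / (20 * K ^ 2)) - 2 * N ≤ q - 2 * δ v := by
      have := hδN v
      linarith
    have h2 := mul_le_mul_of_nonneg_right h1 (hx v)
    have h3 : 0 ≤ 2 * N * x v := mul_nonneg (by positivity) (hx v)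
    by_cases hvD : v ∈ D
    · have hvL : v ∉ L := fun h => (Finset.mem_filter.1 h).2.1 hvD
      simp only [hvD, hvL, if_true, if_false]
      linarith
    · by_cases hvL : v ∈ L
      · simp only [hvD, hvL, if_true, if_false]
        linarith
      · simp only [hvD, hvL, if_false, mul_zero, sub_zero]
        refine mul_le_mul_of_nonneg_right ?_ (hx v)
        have h4 : δ v ≤ N / (60 * K ^ 2) := by
          by_contra! hlt
          exact hvL (Finset.mem_filter.2 ⟨Finset.mem_univ _, hvD, hlt⟩)
        have h5 : N * (1 / (20 * K ^ 2)) = 3 * (N / (60 * K ^ 2)) := by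
          field_simp
          norm_num
        have h6 : 3 * K ^ 2 / N ≤ N / (60 * K ^ 2) := by
          refine hε.trans ?_
          rw [le_div_iff₀ (by positivity)]
          linarith
        linarith
  have htotal := Finset.sum_le_sum fun v (_ : v ∈ Finset.univ) => hpoint v
  rw [hsum, Finset.sum_sub_distrib, Finset.sum_sub_distrib, ← Finset.mul_sum, ← Finset.mul_sum,
    ← Finset.mul_sum, Finset.sum_ite_mem, Finset.sum_ite_mem, Finset.univ_inter,
    Finset.univ_inter, ← hS] at htotal
  have h7 : (1 - 1 / (20 * K ^ 2)) * S ≤ 2 * ∑ v ∈ D, x v + 2 * ∑ v ∈ L, x v := by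
    refine le_of_mul_le_mul_left ?_ hN0
    linarith
  -- Since `2 · 1440 · 80 = 230400`, this needs only `N ≥ 230400 K⁶`. The two errors add up as `1/20
  -- + 1/80 = 1/16`.
  have h8 : 2 * (1440 * K ^ 4 * S / N) ≤ (1 / 80) / K ^ 2 * S := by
    rw [div_mul_eq_mul_div, ← mul_div_assoc, div_le_div_iff₀ hN0 (by positivity)]
    have : 2 * 1440 * K ^ 6 * S ≤ 1 / 80 * N * S := by
      refine mul_le_mul_of_nonneg_right ?_ hS0
      linarith
    linarith
  have h9 : (1 - 1 / (16 * K ^ 2)) * S = (1 - 1 / (20 * K ^ 2)) * S - (1 / 80) / K ^ 2 * S := by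
    field_simp
    ring
  linarith

/-- The numerical contradiction for a vertex of `D` with a non-neighbour. The relative losses are of
order `1 / K` and so cost a bounded amount, about 0.27, against a factor near `2K`; the extra 1 in
`2K + 1` more than pays for this. -/
theorem mul_lt_mul_of_weight {K ε : ℝ} (hK : 1 ≤ K) (hε0 : 0 ≤ ε) (hε : ε * (100 * K) ≤ 1) :
    2 * K < (1 - 1 / (16 * K ^ 2)) *
      ((2 * K + 1 - ε) * ((1 - 1 / (16 * K ^ 2)) * (K - ε / 2) - K + 1)) := by
  have hK0 : 0 < K := by linarith
  obtain ⟨r, hr⟩ : ∃ r, r = 1 / K := ⟨_, rfl⟩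
  have hr0 : 0 < r := by rw [hr]; positivity
  have hr1 : r ≤ 1 := by rw [hr, div_le_one hK0]; exact hK
  have hKr : K * r = 1 := by rw [hr]; field_simp
  have hθ : 1 / (16 * K ^ 2) = r ^ 2 / 16 := by rw [hr]; field_simp
  have hεr : ε ≤ r / 100 := by
    have := mul_le_mul_of_nonneg_right hε hr0.le
    have h2 : ε * (100 * K) * r = 100 * ε := by linear_combination 100 * ε * hKr
    linarith
  rw [hθ]
  have h1 : 1 - r / 16 - r / 200 ≤ (1 - r ^ 2 / 16) * (K - ε / 2) - K + 1 := by
    have : (1 - r ^ 2 / 16) * (K - ε / 2) - K + 1 = 1 - r / 16 * (K * r) - (1 - r ^ 2 / 16) * (ε / 2) := by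
      ring
    rw [this, hKr]
    nlinarith [mul_nonneg (sq_nonneg r) hε0]
  have h2 : 2 * K + 1 - r / 100 ≤ 2 * K + 1 - ε := by linarith
  have h3 : 1 - r / 16 ≤ 1 - r ^ 2 / 16 := by nlinarith
  have h4 : (1 - r / 16) * ((2 * K + 1 - r / 100) * (1 - r / 16 - r / 200)) ≤
      (1 - r ^ 2 / 16) * ((2 * K + 1 - ε) * ((1 - r ^ 2 / 16) * (K - ε / 2) - K + 1)) := by
    have a1 : 0 ≤ 1 - r / 16 := by linarith
    have a2 : 0 ≤ 2 * K + 1 - r / 100 := by linarith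
    have a3 : 0 ≤ 1 - r / 16 - r / 200 := by linarith
    have a4 : 0 ≤ 2 * K + 1 - ε := a2.trans h2
    have a5 : 0 ≤ 1 - r ^ 2 / 16 := a1.trans h3
    gcongr
  refine lt_of_lt_of_le ?_ h4
  have h5 : (1 - r / 16) * (1 - r / 16 - r / 200) ≥ 1 - 27 * r / 200 := by nlinarith
  have h6 : (2 * K + 1 - r / 100) * (1 - 27 * r / 200)
      ≤ (1 - r / 16) * ((2 * K + 1 - r / 100) * (1 - r / 16 - r / 200)) := by
    have a2 : 0 ≤ 2 * K + 1 - r / 100 := by linarith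
    nlinarith [mul_le_mul_of_nonneg_left h5 a2]
  refine lt_of_lt_of_le ?_ h6
  have h7 : (2 * K + 1 - r / 100) * (1 - 27 * r / 200)
      = 2 * K + 1 - r / 100 - 27 / 100 * (K * r) - 27 * r / 200 + 27 * r ^ 2 / 20000 := by ring
  rw [h7, hKr]
  nlinarith [sq_nonneg r]

open Classical in
/-- A graph with large signless Laplacian spectral radius that misses a tree on at most `2k + 3`
vertices has `k` vertices adjacent to all others. -/
theorem exists_dominating {V : Type*} [Fintype V] {G : SimpleGraph V} {k n m : ℕ}
    (hk : 1 ≤ k) (hn : 256000 * k ^ 8 ≤ n) (hV : Fintype.card V = n) (hm : m ≤ 2 * k + 3)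
    (hq : (n : ℝ) + 2 * k - 2 - 3 * k ^ 2 / n ≤ signlessRadius G)
    (hG : ¬ ContainsAllTrees G m) :
    ∃ D : Finset V, D.card = k ∧ ∀ d ∈ D, ∀ v, v ≠ d → G.Adj d v := by
  have hk0 : (1 : ℝ) ≤ k := by exact_mod_cast hk
  have hn' : 256000 * (k : ℝ) ^ 8 ≤ n := by exact_mod_cast hn
  have hkn : 10 * k ≤ n := by
    have : k ≤ k ^ 8 := Nat.le_self_pow (by norm_num) k
    omega
  have hn0 : (0 : ℝ) < n := by exact_mod_cast (by omega : 0 < n)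
  have : Nonempty V := Fintype.card_pos_iff.1 (by omega)
  obtain ⟨x, hx0, hx1, ⟨z, hz⟩, hx⟩ := exists_eigenvector_max_eq_one G
  set q := signlessRadius G
  let δ : V → ℝ := fun v => ((Finset.univ.filter fun u => G.Adj v u).card : ℝ)
  let D : Finset V := Finset.univ.filter fun v => (n : ℝ) - n / (4 * k) ≤ δ v
  have hDk : D.card ≤ k := card_filter_le_degree_le hk hkn hV hm hG
  have hδN : ∀ v, δ v ≤ n - 1 := by
    intro v
    have h1 : (Finset.univ.filter fun u => G.Adj v u) ⊆ Finset.univ.erase v := by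
      intro u hu
      exact Finset.mem_erase.2 ⟨(Finset.mem_filter.1 hu).2.ne', Finset.mem_univ _⟩
    have h2 := Finset.card_le_card h1
    rw [Finset.card_erase_of_mem (Finset.mem_univ _), Finset.card_univ, hV] at h2
    have h3 : (Finset.univ.filter fun u => G.Adj v u).card + 1 ≤ n := by omega
    have h4 : δ v + 1 ≤ n := by
      simp only [δ]
      exact_mod_cast h3
    linarith
  have hδsum : ∑ v, δ v ≤ 6 * k * n := by
    have hG' := hG
    unfold ContainsAllTrees at hG'
    push Not at hG'
    obtain ⟨T, hT, hTG⟩ := hG'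
    have h1 := sum_degree_le_of_not_isContained G hT (d := 2 * k + 1)
      (by rw [Fintype.card_fin]; omega) (not_nonempty_iff.2 hTG) Finset.univ
    rw [Finset.card_univ, hV] at h1
    have h2 : 2 * (2 * k + 1) * n ≤ 6 * k * n := Nat.mul_le_mul_right _ (by omega)
    simp only [δ]
    exact_mod_cast h1.trans h2
  have hle : ∀ v, (q - δ v + 1) * x v ≤ ∑ u, x u := by
    intro v
    have h1 : (∑ u, if G.Adj v u then x u else 0) + x v ≤ ∑ u, x u := by
      rw [← Finset.add_sum_erase _ _ (Finset.mem_univ v), ← Finset.add_sum_erase _ x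
        (Finset.mem_univ v), if_neg G.irrefl, zero_add, add_comm]
      gcongr with u
      split_ifs
      · exact le_rfl
      · exact hx0 u
    have h2 := hx v
    change q * x v = δ v * x v + _ at h2
    linarith
  have hsum : ∑ v, (q - 2 * δ v) * x v = 0 := by
    have h1 : ∑ v, ∑ u, (if G.Adj v u then x u else 0) = ∑ v, δ v * x v := by
      rw [Finset.sum_comm]
      refine Finset.sum_congr rfl fun v _ => ?_
      simp only [G.adj_comm _ v]
      rw [← Finset.sum_filter, Finset.sum_const, nsmul_eq_mul]
    have h2 : ∀ v, (q - 2 * δ v) * x v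
        = (∑ u, if G.Adj v u then x u else 0) - δ v * x v := by
      intro v
      have h2 := hx v
      change q * x v = δ v * x v + _ at h2
      linarith
    simp only [h2, Finset.sum_sub_distrib, h1, sub_self]
  have hweight := weight_le_of_eigenvector (D := D) hk0 hn' hx0 (fun v => Nat.cast_nonneg _) hδN
    hq hδsum hsum hle (fun v hv => by
      by_contra! hlt
      exact hv (Finset.mem_filter.2 ⟨Finset.mem_univ _, hlt.le⟩))
  set S := ∑ v, x v
  set ε : ℝ := 3 * k ^ 2 / n with hεdef
  have hε0 : 0 ≤ ε := by positivity
  have hε : ε * (100 * k) ≤ 1 := by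
    rw [hεdef, div_mul_eq_mul_div, div_le_one hn0]
    have : (k : ℝ) ^ 3 ≤ k ^ 8 := pow_le_pow_right₀ hk0 (by norm_num)
    nlinarith
  set c : ℝ := 1 - 1 / (16 * (k : ℝ) ^ 2) with hc
  have hkey := mul_lt_mul_of_weight hk0 hε0 hε
  rw [← hc] at hkey
  have hc0 : 0 < c := by
    rw [hc, sub_pos, div_lt_one (by positivity)]
    nlinarith
  -- The equation at a maximum entry, whose degree is at most `n - 1`.
  have hSlow : 2 * k - ε ≤ S := by
    have h1 := hle z
    have h2 := hδN z
    rw [hz] at h1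
    linarith
  have hs : c * (k - ε / 2) ≤ ∑ v ∈ D, x v := by
    have := mul_le_mul_of_nonneg_left hSlow hc0.le
    linarith
  have hsD : ∑ v ∈ D, x v ≤ D.card := by
    calc ∑ v ∈ D, x v ≤ ∑ v ∈ D, 1 := Finset.sum_le_sum fun v _ => hx1 v
      _ = D.card := by simp
  have hpos : 0 < c * (k - ε / 2) - k + 1 := by
    by_contra! hcon
    have h1 : 0 ≤ 2 * (k : ℝ) + 1 - ε := by nlinarith
    have h2 := mul_nonpos_of_nonneg_of_nonpos h1 hcon
    have h3 := mul_nonpos_of_nonneg_of_nonpos hc0.le h2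
    linarith
  have hDcard : D.card = k := by
    refine le_antisymm hDk ?_
    have h1 : (k : ℝ) < D.card + 1 := by linarith
    exact Nat.lt_succ_iff.1 (by exact_mod_cast h1)
  refine ⟨D, hDcard, fun d hd v hvd => ?_⟩
  by_contra hadj
  have hδd : δ d ≤ n - 2 := by
    have h1 : (Finset.univ.filter fun u => G.Adj d u) ⊆ (Finset.univ.erase d).erase v := by
      intro u hu
      have h2 := (Finset.mem_filter.1 hu).2
      refine Finset.mem_erase.2 ⟨?_, Finset.mem_erase.2 ⟨h2.ne', Finset.mem_univ _⟩⟩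
      rintro rfl
      exact hadj h2
    have h2 := Finset.card_le_card h1
    rw [Finset.card_erase_of_mem (Finset.mem_erase.2 ⟨hvd, Finset.mem_univ _⟩),
      Finset.card_erase_of_mem (Finset.mem_univ _), Finset.card_univ, hV] at h2
    have h3 : (Finset.univ.filter fun u => G.Adj d u).card + 2 ≤ n := by omega
    have h4 : δ d + 2 ≤ n := by
      simp only [δ]
      exact_mod_cast h3
    linarith
  -- The other `k - 1` entries on `D` are at most 1, so `x d` carries the remaining weight.
  have hxd : c * (k - ε / 2) - k + 1 ≤ x d := by
    have h1 := Finset.add_sum_erase D x hd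
    have h2 : ∑ v ∈ D.erase d, x v ≤ k - 1 := by
      calc ∑ v ∈ D.erase d, x v ≤ ∑ v ∈ D.erase d, 1 := Finset.sum_le_sum fun v _ => hx1 v
        _ = k - 1 := by
          rw [Finset.sum_const, Finset.card_erase_of_mem hd, hDcard, nsmul_eq_mul,
            Nat.cast_sub hk]
          simp
    linarith
  have hSup : c * S ≤ 2 * k := by
    rw [hDcard] at hsD
    linarith
  -- One missing neighbour gains 1 in `q - δ d + 1`; the resulting lower bound for `S` contradicts
  -- `hSup`.
  have h1 : (2 * k + 1 - ε) * (c * (k - ε / 2) - k + 1) ≤ S := by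
    refine le_trans ?_ (hle d)
    have h2 : 2 * k + 1 - ε ≤ q - δ d + 1 := by linarith
    refine mul_le_mul h2 hxd hpos.le ?_
    nlinarith
  have h2 := mul_le_mul_of_nonneg_left h1 hc0.le
  linarith

/-! ### Extremality and uniqueness -/

theorem containsAllTrees_of_graphS_le {V : Type*} [Fintype V] {k n : ℕ} (hk : 1 ≤ k)
    (hn : 256000 * k ^ 8 ≤ n) (hV : Fintype.card V = n) {G : SimpleGraph V}
    (hq : signlessRadius (graphS n k) ≤ signlessRadius G)
    (hiso : ¬ Nonempty (G ≃g graphS n k)) : ContainsAllTrees G (2 * k + 2) := by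
  have hkn : 10 * k ≤ n := by
    have : k ≤ k ^ 8 := Nat.le_self_pow (by norm_num) k
    omega
  by_contra hG
  obtain ⟨D, hDk, hD⟩ := exists_dominating hk hn hV (by omega)
    ((le_signlessRadius_graphS hk (by omega)).trans hq) hG
  refine hiso (nonempty_iso_graphS hV hDk hD fun u hu v hv huv => hG ?_)
  exact containsAllTrees_of_dominating_of_edge hD hDk (by omega) hu hv huv

theorem containsAllTrees_of_graphSPlus_le {V : Type*} [Fintype V] {k n : ℕ} (hk : 1 ≤ k)
    (hn : 256000 * k ^ 8 ≤ n) (hV : Fintype.card V = n) {G : SimpleGraph V}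
    (hq : signlessRadius (graphSPlus n k) ≤ signlessRadius G)
    (hiso : ¬ Nonempty (G ≃g graphSPlus n k)) : ContainsAllTrees G (2 * k + 3) := by
  have hn256 : 256000 * k ≤ n :=
    (Nat.mul_le_mul_left _ (Nat.le_self_pow (by norm_num) k)).trans hn
  have hlow := le_signlessRadius_graphS hk (by omega : k ≤ n)
  have hne : Nonempty (Fin k ⊕ Fin (n - k)) := ⟨Sum.inl ⟨0, hk⟩⟩
  have hlt : signlessRadius (graphS n k) < signlessRadius (graphSPlus n k) := by
    refine signlessRadius_graphS_lt hk (by omega) (lt_of_lt_of_le ?_ hlow)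
    have hk0 : (1 : ℝ) ≤ k := by exact_mod_cast hk
    have hn0 : 256000 * (k : ℝ) ≤ n := by exact_mod_cast hn256
    have h1 : 3 * (k : ℝ) ^ 2 / n ≤ k := by
      rw [div_le_iff₀ (by linarith)]
      nlinarith
    linarith
  by_contra hG
  obtain ⟨D, hDk, hD⟩ := exists_dominating hk hn hV le_rfl (hlow.trans (hlt.le.trans hq)) hG
  by_cases hE : ∃ u ∉ D, ∃ v ∉ D, G.Adj u v
  · obtain ⟨u, hu, v, hv, huv⟩ := hE
    refine hiso (nonempty_iso_graphSPlus hV hDk hD hu hv huv fun a ha b hb hab => ?_)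
    by_contra hab'
    exact hG (containsAllTrees_of_dominating_of_two_edges hk hD hDk (by omega) ha hb hu hv hab huv
      hab')
  -- With no edge outside `D` the graph is `S_{n,k}`, whose `q` is strictly below the assumed bound.
  · push Not at hE
    obtain ⟨e⟩ := nonempty_iso_graphS hV hDk hD hE
    rw [signlessRadius_eq_of_iso e] at hq
    exact hlt.not_ge hq

theorem theorem2 {V : Type*} [Fintype V] (k n : ℕ) (hk : 1 ≤ k) (hn : 256000 * k ^ 8 ≤ n)
    (hV : Fintype.card V = n) :
    -- (a)
    (∀ G : SimpleGraph V, signlessRadius (graphS n k) ≤ signlessRadius G →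
      ¬ Nonempty (G ≃g graphS n k) → ContainsAllTrees G (2 * k + 2)) ∧
    -- (b)
    (∀ G : SimpleGraph V, signlessRadius (graphSPlus n k) ≤ signlessRadius G →
      ¬ Nonempty (G ≃g graphSPlus n k) → ContainsAllTrees G (2 * k + 3)) ∧
    -- `S_{n,k}` is the unique maximiser of `q` among the graphs missing a tree of order `2k + 2`
    (¬ ContainsAllTrees (graphS n k) (2 * k + 2) ∧
      ∀ G : SimpleGraph V, ¬ ContainsAllTrees G (2 * k + 2) →
        signlessRadius G ≤ signlessRadius (graphS n k) ∧
        (signlessRadius G = signlessRadius (graphS n k) → Nonempty (G ≃g graphS n k))) ∧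
    -- `S⁺_{n,k}` is the unique maximiser of `q` among the graphs missing a tree of order `2k + 3`
    (¬ ContainsAllTrees (graphSPlus n k) (2 * k + 3) ∧
      ∀ G : SimpleGraph V, ¬ ContainsAllTrees G (2 * k + 3) →
        signlessRadius G ≤ signlessRadius (graphSPlus n k) ∧
        (signlessRadius G = signlessRadius (graphSPlus n k) →
          Nonempty (G ≃g graphSPlus n k))) := by
  have hne : Nonempty (Fin k ⊕ Fin (n - k)) := ⟨Sum.inl ⟨0, hk⟩⟩
  refine ⟨fun G hq hiso => containsAllTrees_of_graphS_le hk hn hV hq hiso,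
    fun G hq hiso => containsAllTrees_of_graphSPlus_le hk hn hV hq hiso,
    ⟨not_containsAllTrees_graphS n k, fun G hG => ⟨?_, fun hq => ?_⟩⟩,
    ⟨not_containsAllTrees_graphSPlus n k, fun G hG => ⟨?_, fun hq => ?_⟩⟩⟩
  · by_contra! hlt
    by_cases hiso : Nonempty (G ≃g graphS n k)
    · exact hlt.ne' (signlessRadius_eq_of_iso hiso.some)
    · exact hG (containsAllTrees_of_graphS_le hk hn hV hlt.le hiso)
  · by_contra hiso
    exact hG (containsAllTrees_of_graphS_le hk hn hV hq.ge hiso)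
  · by_contra! hlt
    by_cases hiso : Nonempty (G ≃g graphSPlus n k)
    · exact hlt.ne' (signlessRadius_eq_of_iso hiso.some)
    · exact hG (containsAllTrees_of_graphSPlus_le hk hn hV hlt.le hiso)
  · by_contra hiso
    exact hG (containsAllTrees_of_graphSPlus_le hk hn hV hq.ge hiso)
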